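/- Let $\mathbb{T}^2=(\mathbb{R}/2\pi\mathbb{Z})^2$, and for $u\in L^2(\mathbb{T}^2;\mathbb{R}^2)$ with Fourier coefficients $\hat u_k=(2\pi)^{-2}\int_{\mathbb{T}^2}u(x)e^{-ik\cdot x}\,dx$ put $$\|u\|_{H^{s,s'}}^2=\sum_{k\in\mathbb{Z}^2}(1+|k_1|^2)^s(1+|k_2|^2)^{s'}|\hat u_k|^2,\qquad \|u\|_{H^{s}}^2=\sum_{k\in\mathbb{Z}^2}(1+|k|^2)^s|\hat u_k|^2 .$$ For $s,s'\ge 0$ let $\tilde H^{s,s'}$ be the space of all $u\in L^2(\mathbb{T}^2;\mathbb{R}^2)$ with $\operatorname{div}u=0$ and $\|u\|_{\tilde H^{s,s'}}:=\|u\|_{H^{s,s'}}<\infty$. Let $B(u)=P_H(u\cdot\nabla u)$, where $P_H$ is the Leray projection onto divergence free fields. Let $T>0$. For $u_0\in\tilde H^{0,2}$, let $$u^0\in L^\infty([0,T],\tilde H^{0,1})\cap L^2([0,T],\tilde H^{1,1})\cap C([0,T],H^{-1})$$ be the (unique) solution of the deterministic anisotropic Navier--Stokes equation $$\partial_t u^0=\partial_1^2u^0-B(u^0),\qquad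 u^0(0)=u_0,$$ that is, for every smooth divergence free field $\varphi$ on $\mathbb{T}^2$ and every $t\in[0,T]$, $$\langle u^0(t),\varphi\rangle=\langle u_0,\varphi\rangle+\int_0^t\Big(\langle u^0(s),\partial_1^2\varphi\rangle-\langle B(u^0(s)),\varphi\rangle\Big)ds,\qquad \langle B(u),\varphi\rangle=-\sum_{i,j=1}^2\int_{\mathbb{T}^2}u^ju^i\,\partial_j\varphi^i\,dx .$$ Then $$\sup_{t\in[0,T]}\|u^0(t)\|^2_{\tilde H^{0,2}}+\int_0^T\|u^0(t)\|^2_{\tilde H^{1,2}}\,dt\le C,$$ where the constant $C$ depends only on $T$ and on an upper bound for $\|u_0\|_{\tilde H^{0,2}}$. -/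

import Mathlib

open MeasureTheory Set Filter Topology
open scoped ENNReal NNReal

namespace AnisotropicNS

noncomputable section

/-- The circle `ℝ / 2πℤ` has positive circumference. -/
instance two_pi_pos_fact : Fact (0 < 2 * Real.pi) := ⟨Real.two_pi_pos⟩

/-- The two-dimensional torus `𝕋² = (ℝ / 2πℤ)²`; its `volume` has total mass `(2π)²`.
Coordinate `0` is the horizontal variable `x₁`, coordinate `1` the vertical variable `x₂`. -/
abbrev Torus2 : Type := Fin 2 → AddCircle (2 * Real.pi)

/-- The space of values `ℝ²`. -/
abbrev Vec2 : Type := EuclideanSpace ℝ (Fin 2)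

/-- Square integrable vector fields `L²(𝕋²; ℝ²)` (classes modulo a.e. equality). -/
abbrev L2Field : Type := Lp Vec2 2 (volume : Measure Torus2)

/-- The Fourier coefficient `(2π)⁻² ∫ uⁱ(x) e^{-i k·x} dx` of the `i`-th component of `u`. -/
def fieldCoeff (u : L2Field) (k : Fin 2 → ℤ) (i : Fin 2) : ℂ :=
  (1 / (2 * (Real.pi : ℂ)) ^ 2) *
    ∫ x : Torus2, ((u x i : ℝ) : ℂ) * ∏ j : Fin 2, fourier (-(k j)) (x j)

/-- `|û_k|² = ∑ᵢ |ûⁱ_k|²`. -/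
def fourierNormSq (u : L2Field) (k : Fin 2 → ℤ) : ℝ :=
  ∑ i : Fin 2, ‖fieldCoeff u k i‖ ^ 2

/-- The squared Sobolev norm `‖u‖²_{H^s} = ∑_k (1 + |k|²)^s |û_k|² ∈ [0, ∞]`. -/
def sobolevNormSq (s : ℝ) (u : L2Field) : ℝ≥0∞ :=
  ∑' k : Fin 2 → ℤ, ENNReal.ofReal
    ((1 + ((k 0 : ℝ) ^ 2 + (k 1 : ℝ) ^ 2)) ^ s * fourierNormSq u k)

/-- The squared anisotropic Sobolev norm
`‖u‖²_{H^{s,s'}} = ∑_k (1 + |k₁|²)^s (1 + |k₂|²)^{s'} |û_k|² ∈ [0, ∞]`. -/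
def anisoNormSq (s s' : ℝ) (u : L2Field) : ℝ≥0∞ :=
  ∑' k : Fin 2 → ℤ, ENNReal.ofReal
    ((1 + (k 0 : ℝ) ^ 2) ^ s * (1 + (k 1 : ℝ) ^ 2) ^ s' * fourierNormSq u k)

/-- `f : 𝕋² → F` is of class `C^∞`: its lift to a doubly periodic function on `ℝ²` is. -/
def TorusSmooth {F : Type*} [NormedAddCommGroup F] [NormedSpace ℝ F] (f : Torus2 → F) : Prop :=
  ContDiff ℝ (⊤ : ℕ∞) (fun y : Fin 2 → ℝ => f (fun i => ((y i : ℝ) : AddCircle (2 * Real.pi))))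

/-- The partial derivative `∂ⱼ f` of a function on the torus. -/
def pderiv {F : Type*} [NormedAddCommGroup F] [NormedSpace ℝ F] (j : Fin 2) (f : Torus2 → F)
    (x : Torus2) : F :=
  deriv (fun h : ℝ => f (x + Pi.single j ((h : ℝ) : AddCircle (2 * Real.pi)))) 0

/-- `div u = 0` in the sense of distributions on `𝕋²`: `∫ u · ∇ψ = 0` for every smooth `ψ`. -/
def DivFree (u : L2Field) : Prop :=
  ∀ ψ : Torus2 → ℝ, TorusSmooth ψ → ∫ x : Torus2, ∑ j : Fin 2, u x j * pderiv j ψ x = 0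

/-- The space `H̃^{s,s'}` of divergence free fields in `H^{s,s'}(𝕋²; ℝ²)`, for `s, s' ≥ 0`. -/
def anisoSpace (s s' : ℝ) : Set L2Field :=
  {u | anisoNormSq s s' u < ⊤ ∧ DivFree u}

/-- Smooth divergence free test fields on `𝕋²`. -/
def IsTestField (φ : Torus2 → Vec2) : Prop :=
  TorusSmooth φ ∧ ∀ x : Torus2, ∑ j : Fin 2, pderiv j φ x j = 0

/-- The pairing `⟨u, φ⟩ = ∑ᵢ ∫ uⁱ φⁱ dx`. -/
def pairing (u : L2Field) (φ : Torus2 → Vec2) : ℝ :=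
  ∫ x : Torus2, ∑ i : Fin 2, u x i * φ x i

/-- The pairing `⟨∂₁² u, φ⟩ = ⟨u, ∂₁² φ⟩`, with the derivative taken in the sense of
distributions. -/
def viscousForm (u : L2Field) (φ : Torus2 → Vec2) : ℝ :=
  pairing u (pderiv 0 (pderiv 0 φ))

/-- The pairing `⟨B(u), φ⟩` of `B(u) = P_H (u · ∇u)`, where `P_H` is the Leray projection, with a
divergence free test field `φ`. Since `P_H` is symmetric and `P_H φ = φ`, it equals
`⟨u · ∇u, φ⟩`, and as `u · ∇u = div (u ⊗ u)` for divergence free `u`, this is, in the sense of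
distributions, `-∑ᵢⱼ ∫ uʲ uⁱ ∂ⱼφⁱ dx`. -/
def convectionForm (u : L2Field) (φ : Torus2 → Vec2) : ℝ :=
  -∫ x : Torus2, ∑ i : Fin 2, ∑ j : Fin 2, u x j * u x i * pderiv j φ x i

/-- `u` is a solution on `[0, T]`, in the class
`L^∞([0,T], H̃^{0,1}) ∩ L²([0,T], H̃^{1,1}) ∩ C([0,T], H^{-1})`, of the anisotropic
Navier-Stokes equation `∂ₜ u = ∂₁² u - B(u)`, `u(0) = u₀`.
Only the values of `u` on `[0, T]` matter. The values of an element of this class that is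
continuous into `H^{-1}` lie in `L²` (indeed in `H̃^{0,1}`) at every time. -/
structure IsSolution (T : ℝ) (u₀ : L2Field) (u : ℝ → L2Field) : Prop where
  initial : u 0 = u₀
  divFree : ∀ t ∈ Icc 0 T, DivFree (u t)
  bounded : ∃ M : ℝ≥0, ∀ᵐ t ∂(volume.restrict (Icc 0 T)), anisoNormSq 0 1 (u t) ≤ M
  squareIntegrable : ∫⁻ t in Icc 0 T, anisoNormSq 1 1 (u t) < ⊤
  continuous : ∀ t ∈ Icc 0 T,
    Tendsto (fun s => sobolevNormSq (-1) (u s - u t)) (𝓝[Icc 0 T] t) (𝓝 0)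
  equation : ∀ φ : Torus2 → Vec2, IsTestField φ → ∀ t ∈ Icc 0 T,
    pairing (u t) φ = pairing u₀ φ +
      ∫ s in (0 : ℝ)..t, (viscousForm (u s) φ - convectionForm (u s) φ)

end

end AnisotropicNS

namespace AnisotropicNS

noncomputable section

/-! On the Fourier side, each mode satisfies d/dt |v_k|² = 2 Im ∑_p triad(k,p) - 2 k₁² |v_k|², where
triad(k,p) = (v_p · k) ⟨v_{k-p}, v_k⟩. Incompressibility and reality make the triads odd under (k,p)
↦ (p-k,p). A weight w(|k₂|) on the modes therefore leaves only the flux ∑ (w(k) - w(k-p))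
triad(k,p). Viscosity is purely horizontal, so everything rests on bounding this flux by the
horizontal dissipation ∑ k₁² w |v_k|² plus a time integrable multiple of the weighted energy. The
tool is `tsum_trilinear_sq_le`, the discrete form of L^∞_{x₁}L²_{x₂} × L²_{x₁}L^∞_{x₂} × L² → L¹:
one horizontal and one vertical derivative suffice. The relation ∂₂u₂ = -∂₁u₁ replaces missing
vertical derivatives by horizontal ones.

Three weights are used. For w = 1 the flux vanishes, which bounds ‖u‖² and ∫‖∂₁u‖². For w = k₂² the
part built on (∂₂u₁)²(∂₁u₁ + ∂₂u₂) cancels; each surviving term has two horizontal derivatives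
(`flux_sqWeight_eq`). Its bound is ‖∂₁∂₂u‖² + C‖∂₁u‖²(1 + ‖∂₂u‖²), and Grönwall bounds the L² in
time H^{1,1} norm in terms of T and the data alone. For w = k₂⁴ the flux is at most the dissipation
plus (1 + C‖u‖²_{H^{1,1}}) times the energy, and Grönwall applies again.

The H^{0,2} norm is not known to be finite at positive times, so the last step uses the weight (|k₂|
min(|k₂|,N))², at most N²k₂² and hence of finite energy. The estimates are uniform in N, and N tends
to infinity. The given bounds on u serve only to justify convergence and finiteness, so they do not
enter the constant.

The weak formulation yields the mode equations by testing with Re(z e^{-ik·x}) ξ, ξ · k = 0; the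
convolution form of the nonlinearity is Parseval's identity. -/

/-! ### Trilinear sums and Grönwall's inequality -/

/-- The Cauchy-Schwarz inequality for sums in `[0, ∞]`. -/
theorem tsum_mul_sq_le {ι : Type*} (f g : ι → ℝ≥0∞) :
    (∑' i, f i * g i) ^ 2 ≤ (∑' i, f i ^ 2) * ∑' i, g i ^ 2 := by
  have key : ∑' i, f i * g i ≤
      (∑' i, f i ^ 2) ^ (1 / 2 : ℝ) * (∑' i, g i ^ 2) ^ (1 / 2 : ℝ) := by
    rw [ENNReal.tsum_eq_iSup_sum]
    refine iSup_le fun s => ?_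
    refine (ENNReal.inner_le_Lp_mul_Lq s f g Real.HolderConjugate.two_two).trans ?_
    simp only [ENNReal.rpow_two]
    gcongr <;> exact ENNReal.sum_le_tsum s
  calc (∑' i, f i * g i) ^ 2
      ≤ ((∑' i, f i ^ 2) ^ (1 / 2 : ℝ) * (∑' i, g i ^ 2) ^ (1 / 2 : ℝ)) ^ 2 := by gcongr
    _ = _ := by
      rw [mul_pow, ← ENNReal.rpow_two, ← ENNReal.rpow_two, ← ENNReal.rpow_mul,
        ← ENNReal.rpow_mul]
      norm_num

/-- `∑ₙ (l + |n|)⁻² ≤ 4 / l` for `l ≥ 1`. -/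
theorem tsum_inv_add_natAbs_sq_le {l : ℝ≥0} (hl : 1 ≤ l) :
    ∑' n : ℤ, (((l : ℝ≥0∞) + n.natAbs) ^ 2)⁻¹ ≤ 4 / l := by
  have hl1 : (1 : ℝ) ≤ l := by exact_mod_cast hl
  have hl0 : (0 : ℝ) < l := lt_of_lt_of_le one_pos hl1
  have hnat : ∑' n : ℕ, (((l : ℝ≥0∞) + n) ^ 2)⁻¹ ≤ ENNReal.ofReal (2 / l) := by
    rw [ENNReal.tsum_eq_iSup_nat]
    refine iSup_le fun N => ?_
    have e : ∀ n : ℕ, (((l : ℝ≥0∞) + n) ^ 2)⁻¹ = ENNReal.ofReal (((l + n) ^ 2)⁻¹) := by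
      intro n
      rw [ENNReal.ofReal_inv_of_pos (by positivity), ENNReal.ofReal_pow (by positivity),
        ENNReal.ofReal_add (by positivity) (by positivity), ENNReal.ofReal_natCast,
        ENNReal.ofReal_coe_nnreal]
    simp_rw [e]
    rw [← ENNReal.ofReal_sum_of_nonneg (fun _ _ => by positivity)]
    apply ENNReal.ofReal_le_ofReal
    -- Telescoping: 1/x² ≤ 2/x - 2/(x+1) holds exactly because x ≥ 1.
    have : ∀ N : ℕ, ∑ n ∈ Finset.range N, ((l + n : ℝ) ^ 2)⁻¹ ≤ 2 / l - 2 / (l + N) := by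
      intro N
      induction N with
      | zero => simp
      | succ N ih =>
        rw [Finset.sum_range_succ]
        have hx : (1 : ℝ) ≤ l + N := by
          have : (0 : ℝ) ≤ N := by positivity
          linarith
        have h1 : ((l + N : ℝ) ^ 2)⁻¹ ≤ 2 / (l + N) - 2 / (l + (N + 1 : ℕ)) := by
          push_cast
          rw [← add_assoc]
          generalize (l + N : ℝ) = x at hx
          have hx0 : 0 < x := by linarith
          rw [div_sub_div _ _ (by positivity) (by positivity), ← one_div,
            div_le_div_iff₀ (by positivity) (by positivity)]
          nlinarith [mul_nonneg hx0.le (sub_nonneg.2 hx)]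
        linarith
    exact (this N).trans (by have : 0 ≤ 2 / ((l : ℝ) + N) := by positivity
                             linarith)
  have hsum : ∑' n : ℤ, (((l : ℝ≥0∞) + n.natAbs) ^ 2)⁻¹
      = ∑' n : ℕ, (((l : ℝ≥0∞) + n) ^ 2)⁻¹ + ∑' n : ℕ, (((l : ℝ≥0∞) + (n + 1 : ℕ)) ^ 2)⁻¹ := by
    rw [← Equiv.intEquivNatSumNat.symm.tsum_eq, Summable.tsum_sum ENNReal.summable
      ENNReal.summable]
    rfl
  have hshift : ∑' n : ℕ, (((l : ℝ≥0∞) + (n + 1 : ℕ)) ^ 2)⁻¹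
      ≤ ∑' n : ℕ, (((l : ℝ≥0∞) + n) ^ 2)⁻¹ :=
    ENNReal.tsum_comp_le_tsum_of_injective (f := fun n : ℕ => n + 1)
      (add_left_injective 1) (fun n : ℕ => (((l : ℝ≥0∞) + n) ^ 2)⁻¹)
  rw [hsum]
  refine (add_le_add hnat (hshift.trans hnat)).trans (le_of_eq ?_)
  rw [← ENNReal.ofReal_add (by positivity) (by positivity), ← two_mul,
    show (2 * (2 / (l : ℝ))) = 4 / l by ring, ENNReal.ofReal_div_of_pos hl0,
    ENNReal.ofReal_coe_nnreal]
  norm_num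

/-- The anisotropic trilinear estimate: one factor carries an extra horizontal, one an extra
vertical derivative. -/
theorem tsum_trilinear_sq_le {ι : Type*} {l : ℝ≥0} (hl : 1 ≤ l)
    (A B C : (Fin 2 → ℤ) → ℝ≥0∞) (a b c : ι → Fin 2 → ℤ)
    (hab : Function.Injective fun i => (a i, b i))
    (hc : Function.Injective fun i => (c i, a i 0, b i 1)) :
    (∑' i, A (a i) * B (b i) * C (c i)) ^ 2 ≤ (4 / l) ^ 2 *
      (∑' k, ((l + (k 0).natAbs) * A k) ^ 2) * (∑' k, ((l + (k 1).natAbs) * B k) ^ 2) *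
      ∑' k, C k ^ 2 := by
  let α : ℤ → ℝ≥0∞ := fun n => l + n.natAbs
  have hα0 : ∀ n, α n ≠ 0 := fun n => by
    have : (l : ℝ≥0∞) ≠ 0 := by exact_mod_cast (lt_of_lt_of_le one_pos hl).ne'
    simp [α, this]
  have hαt : ∀ n, α n ≠ ⊤ := fun n => by simp [α]
  have e : ∀ i, A (a i) * B (b i) * C (c i) =
      ((α (a i 0) * A (a i)) * (α (b i 1) * B (b i))) *
        (C (c i) * ((α (a i 0))⁻¹ * (α (b i 1))⁻¹)) := by
    intro i
    have h1 := ENNReal.mul_inv_cancel (hα0 (a i 0)) (hαt _)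
    have h2 := ENNReal.mul_inv_cancel (hα0 (b i 1)) (hαt _)
    calc _ = (α (a i 0) * (α (a i 0))⁻¹) * (α (b i 1) * (α (b i 1))⁻¹) *
        (A (a i) * B (b i) * C (c i)) := by rw [h1, h2]; ring
      _ = _ := by ring
  -- Cauchy-Schwarz splits off the inverse weights. Here the indices inject into pairs of
  -- frequencies, so the sum is dominated by a product of two sums.
  have h1 : ∑' i, ((α (a i 0) * A (a i)) * (α (b i 1) * B (b i))) ^ 2 ≤
      (∑' k, (α (k 0) * A k) ^ 2) * ∑' k, (α (k 1) * B k) ^ 2 := by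
    have := ENNReal.tsum_comp_le_tsum_of_injective hab
      (fun x : (Fin 2 → ℤ) × (Fin 2 → ℤ) => (α (x.1 0) * A x.1) ^ 2 * (α (x.2 1) * B x.2) ^ 2)
    simp only [mul_pow (α _ * A _)]
    refine this.trans (le_of_eq ?_)
    rw [ENNReal.tsum_prod (f := fun x y : Fin 2 → ℤ =>
      (α (x 0) * A x) ^ 2 * (α (y 1) * B y) ^ 2)]
    simp_rw [ENNReal.tsum_mul_left, ENNReal.tsum_mul_right]
  -- The remaining factor depends on `c i` and two integers only. By injectivity the two inverse
  -- weights are summed independently, and each sum costs 4 / l.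
  have h2 : ∑' i, (C (c i) * ((α (a i 0))⁻¹ * (α (b i 1))⁻¹)) ^ 2 ≤
      (∑' k, C k ^ 2) * (4 / l) ^ 2 := by
    have := ENNReal.tsum_comp_le_tsum_of_injective hc
      (fun x : (Fin 2 → ℤ) × ℤ × ℤ => C x.1 ^ 2 * ((α x.2.1 ^ 2)⁻¹ * (α x.2.2 ^ 2)⁻¹))
    simp only [mul_pow, ← ENNReal.inv_pow]
    refine this.trans ?_
    rw [ENNReal.tsum_prod (f := fun (x : Fin 2 → ℤ) (y : ℤ × ℤ) =>
      C x ^ 2 * ((α y.1 ^ 2)⁻¹ * (α y.2 ^ 2)⁻¹))]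
    simp_rw [ENNReal.tsum_mul_left, ENNReal.tsum_mul_right]
    gcongr
    rw [ENNReal.tsum_prod (f := fun x y : ℤ => (α x ^ 2)⁻¹ * (α y ^ 2)⁻¹)]
    simp_rw [ENNReal.tsum_mul_left, ENNReal.tsum_mul_right]
    rw [sq]
    exact mul_le_mul' (tsum_inv_add_natAbs_sq_le hl) (tsum_inv_add_natAbs_sq_le hl)
  simp_rw [e]
  refine (tsum_mul_sq_le _ _).trans ((mul_le_mul' h1 h2).trans (le_of_eq ?_))
  ring

/-- Grönwall's inequality in integral form with an integrable coefficient. -/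
theorem le_two_pow_mul_of_le_add_lintegral {T : ℝ} {h y : ℝ → ℝ≥0∞} (hm : Measurable h)
    {A H : ℝ≥0∞} (hH : ∫⁻ s in Ioc 0 T, h s ≤ H) (hHt : H ≠ ⊤)
    (hfin : ∫⁻ s in Ioc 0 T, h s * y s ≠ ⊤) 
    (hy : ∀ t ∈ Icc 0 T, y t ≤ A + ∫⁻ s in Ioc 0 t, h s * y s) {n : ℕ} (hn : 2 * H ≤ n) :
    ∀ t ∈ Icc 0 T, y t ≤ 2 ^ n * A := by
  by_cases hA : A = ⊤
  · intro t _
    simp [hA, ENNReal.mul_top]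
  have hhfin : ∫⁻ s in Ioc 0 T, h s ≠ ⊤ := ne_top_of_le_ne_top hHt hH
  have hcont : ContinuousOn (fun t => ∫⁻ s in Ioc 0 t, h s) (Icc 0 T) := by
    have hint : IntegrableOn (fun s => (h s).toReal) (Icc 0 T) := by
      rw [integrableOn_Icc_iff_integrableOn_Ioc (by finiteness)]
      exact integrable_toReal_of_lintegral_ne_top hm.aemeasurable hhfin
    refine (ENNReal.continuous_ofReal.comp_continuousOn
      (intervalIntegral.continuousOn_primitive hint)).congr fun t ht => ?_
    have ht' : ∫⁻ s in Ioc 0 t, h s ≠ ⊤ :=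
      ne_top_of_le_ne_top hhfin (lintegral_mono_set (Ioc_subset_Ioc_right ht.2))
    simp only [Function.comp]
    rw [integral_toReal hm.aemeasurable (ae_lt_top hm ht'), ENNReal.ofReal_toReal ht']
  have hadd : ∀ (f : ℝ → ℝ≥0∞) {r t : ℝ}, r ∈ Icc 0 t →
      ∫⁻ s in Ioc 0 t, f s = (∫⁻ s in Ioc 0 r, f s) + ∫⁻ s in Ioc r t, f s := by
    intro f r t hr
    rw [← Ioc_union_Ioc_eq_Ioc hr.1 hr.2, lintegral_union measurableSet_Ioc
      (Set.Ioc_disjoint_Ioc_of_le le_rfl)]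
  -- Induction on the number of time intervals on which `h` has mass at most 1/2; each interval
  -- doubles the bound.
  have key : ∀ n : ℕ, ∀ t ∈ Icc 0 T, 2 * ∫⁻ s in Ioc 0 t, h s ≤ n →
      A + ∫⁻ s in Ioc 0 t, h s * y s ≤ 2 ^ n * A := by
    intro n
    induction n with
    | zero =>
      intro t ht h0
      have : ∫⁻ s in Ioc 0 t, h s = 0 := by simpa using h0
      have : ∫⁻ s in Ioc 0 t, h s * y s = 0 := by
        have := (lintegral_eq_zero_iff hm).1 this
        refine (lintegral_congr_ae ?_).trans lintegral_zero
        filter_upwards [this] with s hs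
        simp [hs]
      simp [this]
    | succ n ih =>
      intro t ht h0
      obtain ⟨r, hr, hr1, hr2⟩ : ∃ r ∈ Icc 0 t, 2 * ∫⁻ s in Ioc 0 r, h s ≤ n ∧
          2 * ∫⁻ s in Ioc r t, h s ≤ 1 := by
        rcases le_total (2 * ∫⁻ s in Ioc 0 t, h s) n with hle | hge
        · exact ⟨t, ⟨ht.1, le_rfl⟩, hle, by simp⟩
        have hge' : (n : ℝ≥0∞) / 2 ≤ ∫⁻ s in Ioc 0 t, h s :=
          ENNReal.div_le_of_le_mul' hge
        obtain ⟨r, hr, hr'⟩ := intermediate_value_Icc ht.1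
          (hcont.mono (Icc_subset_Icc_right ht.2)) (show (n : ℝ≥0∞) / 2 ∈ Icc _ _ from
            ⟨by simp, hge'⟩)
        have hr2 : 2 * ∫⁻ s in Ioc 0 r, h s = n := by
          simp only at hr'
          rw [hr', ENNReal.mul_div_cancel two_ne_zero ENNReal.ofNat_ne_top]
        refine ⟨r, hr, hr2.le, ?_⟩
        rw [hadd h hr, mul_add, hr2, Nat.cast_add, Nat.cast_one] at h0
        exact (ENNReal.add_le_add_iff_left (ENNReal.natCast_ne_top n)).1 h0
      have hrT : r ∈ Icc 0 T := ⟨hr.1, hr.2.trans ht.2⟩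
      have hsplit : ∫⁻ s in Ioc 0 t, h s * y s =
          (∫⁻ s in Ioc 0 r, h s * y s) + ∫⁻ s in Ioc r t, h s * y s := hadd _ hr
      set Φ := A + ∫⁻ s in Ioc 0 t, h s * y s with hΦ
      have hΦt : Φ ≠ ⊤ := ENNReal.add_ne_top.2 ⟨hA, ne_top_of_le_ne_top hfin
        (lintegral_mono_set (Ioc_subset_Ioc_right ht.2))⟩
      have h3 : ∫⁻ s in Ioc r t, h s * y s ≤ (∫⁻ s in Ioc r t, h s) * Φ := by
        rw [← lintegral_mul_const _ hm]
        refine setLIntegral_mono' measurableSet_Ioc fun s hs => ?_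
        gcongr
        refine (hy s ⟨hr.1.trans hs.1.le, hs.2.trans ht.2⟩).trans ?_
        exact add_le_add le_rfl (lintegral_mono_set (Ioc_subset_Ioc_right hs.2))
      -- On the last interval Φ(t) ≤ Φ(r) + Φ(t)/2. The finiteness of Φ permits absorbing the last
      -- term.
      have h4 : 2 * Φ ≤ 2 * (2 ^ n * A) + Φ := by
        calc 2 * Φ = 2 * (A + ∫⁻ s in Ioc 0 r, h s * y s) + 2 * ∫⁻ s in Ioc r t, h s * y s := by
              rw [hΦ, hsplit, ← add_assoc, mul_add 2 (A + _)]
          _ ≤ 2 * (2 ^ n * A) + 2 * ((∫⁻ s in Ioc r t, h s) * Φ) := by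
              gcongr; exact ih r hrT hr1
          _ ≤ 2 * (2 ^ n * A) + Φ := by
              rw [← mul_assoc 2 (∫⁻ s in Ioc r t, h s) Φ]
              gcongr
              exact mul_le_of_le_one_left' hr2
      rw [two_mul Φ] at h4
      have := ENNReal.le_of_add_le_add_right hΦt h4
      rwa [pow_succ', mul_assoc]
  intro t ht
  refine (hy t ht).trans (key n t ht ?_)
  refine le_trans ?_ hn
  gcongr
  exact (lintegral_mono_set (Ioc_subset_Ioc_right ht.2)).trans hH
-- Triads and their symmetries
/-- Sequences of Fourier coefficients of complex vector fields on the torus. -/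
abbrev FourierField : Type := (Fin 2 → ℤ) → EuclideanSpace ℂ (Fin 2)

/-- The Fourier coefficients of a real divergence free field. -/
structure IsRealDivFree (v : FourierField) : Prop where
  div : ∀ k, (k 0 : ℂ) * v k 0 + (k 1 : ℂ) * v k 1 = 0
  real : ∀ k i, v (-k) i = (starRingEnd ℂ) (v k i)

/-- The weighted sum `∑ₖ ω(k) |vₖ|²`. -/
def weightedEnergy (ω : (Fin 2 → ℤ) → ℝ≥0∞) (v : FourierField) : ℝ≥0∞ :=
  ∑' k, ω k * ‖v k‖ₑ ^ 2

/-- The size of the horizontal frequency. -/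
def horiz (k : Fin 2 → ℤ) : ℝ≥0∞ := (k 0).natAbs

/-- The size of the vertical frequency. -/
def vert (k : Fin 2 → ℤ) : ℝ≥0∞ := (k 1).natAbs

/-- The interaction `(v_p · k) ⟨v_{k-p}, v_k⟩` of the frequencies `p` and `k - p` with `k`, at
`x = (k, p)`. -/
def triad (v : FourierField) (x : (Fin 2 → ℤ) × (Fin 2 → ℤ)) : ℂ :=
  (v x.2 0 * x.1 0 + v x.2 1 * x.1 1) * inner ℂ (v x.1) (v (x.1 - x.2))

theorem weightedEnergy_mono {ω ω' : (Fin 2 → ℤ) → ℝ≥0∞} (h : ∀ k, ω k ≤ ω' k)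
    (v : FourierField) : weightedEnergy ω v ≤ weightedEnergy ω' v :=
  ENNReal.tsum_le_tsum fun k => by gcongr; exact h k

theorem weightedEnergy_add (ω ω' : (Fin 2 → ℤ) → ℝ≥0∞) (v : FourierField) :
    weightedEnergy (fun k => ω k + ω' k) v = weightedEnergy ω v + weightedEnergy ω' v := by
  simp only [weightedEnergy, add_mul, ENNReal.tsum_add]

theorem weightedEnergy_const_mul (c : ℝ≥0∞) (ω : (Fin 2 → ℤ) → ℝ≥0∞) (v : FourierField) :
    weightedEnergy (fun k => c * ω k) v = c * weightedEnergy ω v := by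
  simp only [weightedEnergy, mul_assoc, ENNReal.tsum_mul_left]

theorem enorm_apply_le (w : EuclideanSpace ℂ (Fin 2)) (i : Fin 2) : ‖w i‖ₑ ≤ ‖w‖ₑ := by
  rw [← ofReal_norm, ← ofReal_norm]
  exact ENNReal.ofReal_le_ofReal (PiLp.norm_apply_le w i)

theorem enorm_intCast (n : ℤ) : ‖(n : ℂ)‖ₑ = n.natAbs := by
  rw [← ofReal_norm, Complex.norm_intCast, ← ENNReal.ofReal_natCast, Nat.cast_natAbs,
    Int.cast_abs]

theorem enorm_inner_le (a b : EuclideanSpace ℂ (Fin 2)) : ‖(inner ℂ a b : ℂ)‖ₑ ≤ ‖a‖ₑ * ‖b‖ₑ := by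
  rw [← ofReal_norm, ← ofReal_norm, ← ofReal_norm, ← ENNReal.ofReal_mul (norm_nonneg _)]
  exact ENNReal.ofReal_le_ofReal (norm_inner_le_norm a b)

theorem add_sq_le_two_mul (a b : ℝ≥0∞) : (a + b) ^ 2 ≤ 2 * (a ^ 2 + b ^ 2) := by
  have := ENNReal.rpow_add_le_mul_rpow_add_rpow a b (p := 2) (by norm_num)
  norm_num at this
  exact this

theorem inner_eq (a b : EuclideanSpace ℂ (Fin 2)) :
    (inner ℂ a b : ℂ) = b 0 * (starRingEnd ℂ) (a 0) + b 1 * (starRingEnd ℂ) (a 1) := by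
  simp [PiLp.inner_apply]

namespace IsRealDivFree

variable {v : FourierField}

/-- Incompressibility exchanges a vertical derivative of the vertical component for a horizontal
derivative of the horizontal one. This compensates for the absence of vertical viscosity. -/
theorem vert_mul_enorm (hv : IsRealDivFree v) (k : Fin 2 → ℤ) :
    vert k * ‖v k 1‖ₑ = horiz k * ‖v k 0‖ₑ := by
  have h : (k 1 : ℂ) * v k 1 = -((k 0 : ℂ) * v k 0) := by
    linear_combination hv.div k
  rw [vert, horiz, ← enorm_intCast, ← enorm_intCast, ← enorm_mul, ← enorm_mul, h, enorm_neg]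

/-- Since p · v_p = 0, the derivative may be taken to act on the transported factor only. -/
theorem triad_eq (hv : IsRealDivFree v) (x : (Fin 2 → ℤ) × (Fin 2 → ℤ)) :
    triad v x = (v x.2 0 * (x.1 - x.2) 0 + v x.2 1 * (x.1 - x.2) 1) *
      inner ℂ (v x.1) (v (x.1 - x.2)) := by
  have := hv.div x.2
  rw [triad]
  congr 1
  push_cast [Pi.sub_apply]
  linear_combination this

theorem enorm_triad_le (hv : IsRealDivFree v) (x : (Fin 2 → ℤ) × (Fin 2 → ℤ)) :
    ‖triad v x‖ₑ ≤ (‖v x.2 0‖ₑ * horiz (x.1 - x.2) + ‖v x.2 1‖ₑ * vert (x.1 - x.2)) *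
      ‖v (x.1 - x.2)‖ₑ * ‖v x.1‖ₑ := by
  rw [horiz, vert, ← enorm_intCast, ← enorm_intCast, ← enorm_mul, ← enorm_mul, hv.triad_eq,
    enorm_mul]
  refine (mul_le_mul' (enorm_add_le (v x.2 0 * ((x.1 - x.2) 0 : ℂ)) _)
    (enorm_inner_le _ _)).trans (le_of_eq ?_)
  ring

end IsRealDivFree

/-- The involution `(k, p) ↦ (p - k, p)`. -/
def reflectPair : (Fin 2 → ℤ) × (Fin 2 → ℤ) ≃ (Fin 2 → ℤ) × (Fin 2 → ℤ) :=
  Function.Involutive.toPerm (fun x => (x.2 - x.1, x.2)) fun x => by simp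

/-- The involution `(k, p) ↦ (k, k - p)`. -/
def swapPair : (Fin 2 → ℤ) × (Fin 2 → ℤ) ≃ (Fin 2 → ℤ) × (Fin 2 → ℤ) :=
  Function.Involutive.toPerm (fun x => (x.1, x.1 - x.2)) fun x => by simp

@[simp] theorem reflectPair_apply (x : (Fin 2 → ℤ) × (Fin 2 → ℤ)) :
    reflectPair x = (x.2 - x.1, x.2) := rfl

@[simp] theorem swapPair_apply (x : (Fin 2 → ℤ) × (Fin 2 → ℤ)) :
    swapPair x = (x.1, x.1 - x.2) := rfl

/-- Reflection exchanges the two output modes k and k - p up to sign; reality turns the inner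
product back into the original one and p · v_p = 0 adjusts the transport factor. This is the
discrete form of ∫ (u·∇f)·f = 0. -/
theorem IsRealDivFree.triad_reflectPair {v : FourierField} (hv : IsRealDivFree v)
    (x : (Fin 2 → ℤ) × (Fin 2 → ℤ)) : triad v (reflectPair x) = -triad v x := by
  obtain ⟨k, p⟩ := x
  have h1 : p - k - p = -k := by abel
  have h2 : p - k = -(k - p) := by abel
  have hd := hv.div p
  simp only [triad, reflectPair_apply, h1, inner_eq]
  rw [h2]
  simp only [hv.real, Complex.conj_conj, Pi.neg_apply, Pi.sub_apply]
  push_cast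
  linear_combination (v (k - p) 0 * (starRingEnd ℂ) (v k 0) +
    v (k - p) 1 * (starRingEnd ℂ) (v k 1)) * hd

/-- A pair of frequencies is determined by the second one and the difference. -/
theorem injective_pair_sub : Function.Injective
    (fun x : (Fin 2 → ℤ) × (Fin 2 → ℤ) => (x.2, x.1 - x.2)) := by
  rintro ⟨k, p⟩ ⟨k', p'⟩ h
  simp only [Prod.mk.injEq] at h ⊢
  obtain ⟨rfl, h⟩ := h
  exact ⟨sub_left_injective h, rfl⟩

theorem injective_sub_pair : Function.Injective
    (fun x : (Fin 2 → ℤ) × (Fin 2 → ℤ) => (x.1 - x.2, x.2)) := by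
  rintro ⟨k, p⟩ ⟨k', p'⟩ h
  simp only [Prod.mk.injEq] at h ⊢
  obtain ⟨h, rfl⟩ := h
  exact ⟨sub_left_injective h, rfl⟩

/-- The weighted sum of the triads splits into two trilinear sums. -/
theorem IsRealDivFree.tsum_triad_sq_le {v : FourierField} (hv : IsRealDivFree v)
    (μ ν κ : (Fin 2 → ℤ) → ℝ≥0∞) :
    (∑' x : (Fin 2 → ℤ) × (Fin 2 → ℤ), μ x.2 * ν (x.1 - x.2) * κ x.1 *
        ((‖v x.2 0‖ₑ * horiz (x.1 - x.2) + ‖v x.2 1‖ₑ * vert (x.1 - x.2)) *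
      ‖v (x.1 - x.2)‖ₑ * ‖v x.1‖ₑ)) ^ 2 ≤
      32 * weightedEnergy (fun k => ((1 + horiz k) * μ k) ^ 2) v *
        (weightedEnergy (fun k => ((1 + vert k) * ν k * horiz k) ^ 2) v +
          weightedEnergy (fun k => ((1 + horiz k) * ν k * vert k) ^ 2) v) *
        weightedEnergy (fun k => κ k ^ 2) v := by
  have h1 := tsum_trilinear_sq_le (l := 1) le_rfl
    (fun k => μ k * ‖v k 0‖ₑ) (fun k => ν k * horiz k * ‖v k‖ₑ) (fun k => κ k * ‖v k‖ₑ)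
    (fun x : (Fin 2 → ℤ) × (Fin 2 → ℤ) => x.2) (fun x => x.1 - x.2) (fun x => x.1)
    injective_pair_sub (by
      rintro ⟨k, p⟩ ⟨k', p'⟩ h
      simp only [Prod.mk.injEq] at h ⊢
      obtain ⟨rfl, h0, h1⟩ := h
      refine ⟨rfl, funext fun i => ?_⟩
      fin_cases i
      · exact h0
      · simpa using h1)
  -- In the vertical transport term the roles are exchanged: the transported factor receives the
  -- horizontal weight, and the transporting component `v p 1` the vertical one.
  have h2 := tsum_trilinear_sq_le (l := 1) le_rfl
    (fun k => ν k * vert k * ‖v k‖ₑ) (fun k => μ k * ‖v k 1‖ₑ) (fun k => κ k * ‖v k‖ₑ)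
    (fun x : (Fin 2 → ℤ) × (Fin 2 → ℤ) => x.1 - x.2) (fun x => x.2) (fun x => x.1)
    injective_sub_pair (by
      rintro ⟨k, p⟩ ⟨k', p'⟩ h
      simp only [Prod.mk.injEq] at h ⊢
      obtain ⟨rfl, h0, h1⟩ := h
      refine ⟨rfl, funext fun i => ?_⟩
      fin_cases i
      · simpa using h0
      · exact h1)
  set X1 := ∑' x : (Fin 2 → ℤ) × (Fin 2 → ℤ), μ x.2 * ‖v x.2 0‖ₑ *
    (ν (x.1 - x.2) * horiz (x.1 - x.2) * ‖v (x.1 - x.2)‖ₑ) * (κ x.1 * ‖v x.1‖ₑ)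
  set X2 := ∑' x : (Fin 2 → ℤ) × (Fin 2 → ℤ),
    ν (x.1 - x.2) * vert (x.1 - x.2) * ‖v (x.1 - x.2)‖ₑ * (μ x.2 * ‖v x.2 1‖ₑ) *
      (κ x.1 * ‖v x.1‖ₑ)
  have e : ∑' x : (Fin 2 → ℤ) × (Fin 2 → ℤ), μ x.2 * ν (x.1 - x.2) * κ x.1 *
        ((‖v x.2 0‖ₑ * horiz (x.1 - x.2) + ‖v x.2 1‖ₑ * vert (x.1 - x.2)) *
      ‖v (x.1 - x.2)‖ₑ * ‖v x.1‖ₑ) = X1 + X2 := by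
    rw [← ENNReal.tsum_add]
    exact tsum_congr fun x => by ring
  have a1 : ∑' k, (((1 : ℝ≥0) + ((k 0).natAbs : ℝ≥0∞)) * (μ k * ‖v k 0‖ₑ)) ^ 2 ≤
      weightedEnergy (fun k => ((1 + horiz k) * μ k) ^ 2) v := by
    refine ENNReal.tsum_le_tsum fun k => ?_
    rw [← mul_pow, ENNReal.coe_one, ← mul_assoc]
    gcongr
    · exact le_rfl
    · exact enorm_apply_le _ _
  have b1 : ∑' k, (((1 : ℝ≥0) + ((k 1).natAbs : ℝ≥0∞)) * (ν k * horiz k * ‖v k‖ₑ)) ^ 2 =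
      weightedEnergy (fun k => ((1 + vert k) * ν k * horiz k) ^ 2) v := by
    refine tsum_congr fun k => ?_
    rw [← mul_pow, ENNReal.coe_one, vert]
    ring
  have c1 : ∑' k, (κ k * ‖v k‖ₑ) ^ 2 = weightedEnergy (fun k => κ k ^ 2) v := by
    refine tsum_congr fun k => ?_
    rw [mul_pow]
  have a2 : ∑' k, (((1 : ℝ≥0) + ((k 0).natAbs : ℝ≥0∞)) * (ν k * vert k * ‖v k‖ₑ)) ^ 2 =
      weightedEnergy (fun k => ((1 + horiz k) * ν k * vert k) ^ 2) v := by
    refine tsum_congr fun k => ?_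
    rw [← mul_pow, ENNReal.coe_one, horiz]
    ring
  -- The vertical weight on the vertical component becomes a horizontal one by incompressibility, so
  -- both trilinear sums involve the same norm of the transporting field.
  have b2 : ∑' k, (((1 : ℝ≥0) + ((k 1).natAbs : ℝ≥0∞)) * (μ k * ‖v k 1‖ₑ)) ^ 2 ≤
      weightedEnergy (fun k => ((1 + horiz k) * μ k) ^ 2) v := by
    refine ENNReal.tsum_le_tsum fun k => ?_
    rw [← mul_pow, ENNReal.coe_one]
    refine pow_le_pow_left' ?_ 2
    calc (1 + ((k 1).natAbs : ℝ≥0∞)) * (μ k * ‖v k 1‖ₑ)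
        = μ k * ‖v k 1‖ₑ + μ k * (vert k * ‖v k 1‖ₑ) := by rw [vert]; ring
      _ ≤ μ k * ‖v k‖ₑ + μ k * (horiz k * ‖v k‖ₑ) := by
          rw [hv.vert_mul_enorm]
          gcongr <;> exact enorm_apply_le _ _
      _ = _ := by ring
  rw [e]
  refine (add_sq_le_two_mul X1 X2).trans ?_
  rw [b1, c1] at h1
  rw [a2, c1] at h2
  have h1' := h1.trans (mul_le_mul_left (mul_le_mul_left (mul_le_mul_right a1 _) _) _)
  have h2' := h2.trans (mul_le_mul_left (mul_le_mul_right b2 _) _)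
  refine (mul_le_mul_right (add_le_add h1' h2') 2).trans (le_of_eq ?_)
  rw [ENNReal.coe_one, div_one]
  ring
-- Energy flux and the truncated second order weight
/-- The squared norm `‖v‖²_{H^{1,1}}`, up to a constant. -/
def energyOneOne (v : FourierField) : ℝ≥0∞ :=
  weightedEnergy (fun k => ((1 + horiz k) * (1 + vert k)) ^ 2) v

/-- The weight of a frequency given by a function of the size of its vertical component. -/
def verticalWeight (w : ℕ → ℝ≥0) (k : Fin 2 → ℤ) : ℝ≥0∞ := w (k 1).natAbs

/-- The difference of the weights of the frequencies `k` and `k - p`. -/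
def weightDiff (w : ℕ → ℝ≥0) (x : (Fin 2 → ℤ) × (Fin 2 → ℤ)) : ℝ :=
  w (x.1 1).natAbs - w ((x.1 - x.2) 1).natAbs

/-- The energy flux `∑ (w(k) - w(k - p)) (v_p · k) ⟨v_{k-p}, v_k⟩`. -/
def flux (w : ℕ → ℝ≥0) (v : FourierField) : ℂ :=
  ∑' x, (weightDiff w x : ℂ) * triad v x

/-- The sum of the absolute values of the terms of the energy flux. -/
def absFlux (w : ℕ → ℝ≥0) (v : FourierField) : ℝ≥0∞ :=
  ∑' x, ‖weightDiff w x‖ₑ * ‖triad v x‖ₑ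

theorem IsRealDivFree.tsum_mul_triad_sq_le {v : FourierField} (hv : IsRealDivFree v)
    (μ ν κ : (Fin 2 → ℤ) → ℝ≥0∞) :
    (∑' x : (Fin 2 → ℤ) × (Fin 2 → ℤ), μ x.2 * ν (x.1 - x.2) * κ x.1 * ‖triad v x‖ₑ) ^ 2 ≤
      32 * weightedEnergy (fun k => ((1 + horiz k) * μ k) ^ 2) v *
        (weightedEnergy (fun k => ((1 + vert k) * ν k * horiz k) ^ 2) v +
          weightedEnergy (fun k => ((1 + horiz k) * ν k * vert k) ^ 2) v) *
        weightedEnergy (fun k => κ k ^ 2) v := by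
  refine le_trans ?_ (hv.tsum_triad_sq_le μ ν κ)
  refine pow_le_pow_left' (ENNReal.tsum_le_tsum fun x => ?_) 2
  gcongr
  exact hv.enorm_triad_le x

theorem IsRealDivFree.enorm_triad_reflectPair {v : FourierField} (hv : IsRealDivFree v)
    (x : (Fin 2 → ℤ) × (Fin 2 → ℤ)) : ‖triad v (reflectPair x)‖ₑ = ‖triad v x‖ₑ := by
  rw [hv.triad_reflectPair, enorm_neg]

/-- Absolute summability of the triads whenever the H^{1,1} norm is finite. It justifies rearranging
the double sums for bounded weights. -/
theorem IsRealDivFree.tsum_enorm_triad_sq_le {v : FourierField} (hv : IsRealDivFree v) :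
    (∑' x, ‖triad v x‖ₑ) ^ 2 ≤
      64 * energyOneOne v * energyOneOne v * weightedEnergy (fun _ => 1) v := by
  have h := hv.tsum_mul_triad_sq_le (fun _ => 1) (fun _ => 1) (fun _ => 1)
  simp only [one_mul, mul_one, one_pow] at h
  refine h.trans ?_
  calc _ ≤ 32 * energyOneOne v * (energyOneOne v + energyOneOne v) *
        weightedEnergy (fun _ => 1) v := by
        gcongr
        · refine weightedEnergy_mono (fun k => ?_) v
          gcongr
          exact le_mul_of_one_le_right' le_self_add
        · refine weightedEnergy_mono (fun k => ?_) v
          rw [mul_comm]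
          gcongr
          exact le_add_self
        · refine weightedEnergy_mono (fun k => ?_) v
          gcongr
          exact le_add_self
    _ = _ := by ring

theorem weightDiff_const (c : ℝ≥0) (x : (Fin 2 → ℤ) × (Fin 2 → ℤ)) :
    weightDiff (fun _ => c) x = 0 := by simp [weightDiff]

theorem enorm_flux_le (w : ℕ → ℝ≥0) (v : FourierField) : ‖flux w v‖ₑ ≤ absFlux w v := by
  by_cases h : absFlux w v = ⊤
  · simp [h]
  have e : absFlux w v = ∑' x, ‖(weightDiff w x : ℂ) * triad v x‖ₑ := by
    refine tsum_congr fun x => ?_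
    rw [enorm_mul, ← ofReal_norm (weightDiff w x : ℂ), Complex.norm_real, ofReal_norm]
  rw [e] at h ⊢
  exact enorm_tsum_le_tsum_enorm

/-- A discrete product rule for the symbol n min(n, N). The cross term keeps the truncation on `b`,
so that after the vertical weight of the trilinear estimate is applied the truncated symbol
reappears. -/
theorem mul_min_le_of_le_add {a b c N : ℕ} (h : a ≤ b + c) :
    a * min a N ≤ b * min b N + 2 * (c * min c N) + 2 * (c * min b N) := by
  have h1 : a * min a N ≤ (b + c) * min (b + c) N := by gcongr
  refine h1.trans ?_
  have h2 : b * min (b + c) N ≤ b * min b N + c * min b N := by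
    rcases le_total N b with hN | hN
    · rw [min_eq_right hN, min_eq_right (by omega)]; omega
    · rw [min_eq_left hN]
      calc b * min (b + c) N ≤ b * (b + c) := by gcongr; exact min_le_left _ _
        _ = _ := by ring
  have h3 : c * min (b + c) N ≤ c * min b N + c * min c N := by
    rw [← mul_add]
    gcongr
    omega
  have h4 := Nat.zero_le (c * min c N)
  rw [add_mul]
  linarith

/-- The truncated second order vertical weight `(|n| min(|n|, N))²`. -/
def truncWeight (N n : ℕ) : ℝ≥0 := (n * min n N : ℕ) ^ 2

/-- The square root of the truncated weight. -/
def truncSymbol (N : ℕ) (k : Fin 2 → ℤ) : ℝ≥0∞ := ((k 1).natAbs * min (k 1).natAbs N : ℕ)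

/-- The truncated first order symbol `min(|k₂|, N)`. -/
def vertMin (N : ℕ) (k : Fin 2 → ℤ) : ℝ≥0∞ := (min (k 1).natAbs N : ℕ)

theorem verticalWeight_truncWeight (N : ℕ) (k : Fin 2 → ℤ) :
    verticalWeight (truncWeight N) k = truncSymbol N k ^ 2 := by
  simp only [verticalWeight, truncWeight, truncSymbol]
  generalize min (k 1).natAbs N = m
  push_cast
  rfl

/-- The difference of squares factors, and the sum of the roots is at most twice the larger. Adding
both cases gives a bound of the form that `absFlux_le_two_mul` can symmetrize. -/
theorem enorm_sub_sq_le {a b c d : ℝ≥0} (h1 : a ≤ b + c) (h2 : b ≤ a + d) :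
    ‖((a ^ 2 : ℝ≥0) : ℝ) - ((b ^ 2 : ℝ≥0) : ℝ)‖ₑ ≤ 2 * (c * a) + 2 * (d * b) := by
  have : |((a ^ 2 : ℝ≥0) : ℝ) - ((b ^ 2 : ℝ≥0) : ℝ)| ≤
      ((2 * (c * a) + 2 * (d * b) : ℝ≥0) : ℝ) := by
    have h1' : (a : ℝ) ≤ b + c := by exact_mod_cast h1
    have h2' : (b : ℝ) ≤ a + d := by exact_mod_cast h2
    have ha := a.2
    have hb := b.2
    have hc := c.2
    have hd := d.2
    push_cast
    have hca := mul_nonneg hc ha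
    have hdb := mul_nonneg hd hb
    rcases le_total (a : ℝ) b with h | h
    · rw [abs_of_nonpos (by nlinarith)]
      nlinarith
    · rw [abs_of_nonneg (by nlinarith)]
      nlinarith
  rw [← ofReal_norm, Real.norm_eq_abs]
  refine (ENNReal.ofReal_le_ofReal this).trans ?_
  rw [ENNReal.ofReal_coe_nnreal]
  push_cast
  exact le_rfl

theorem natAbs_vert_triangle (k p : Fin 2 → ℤ) :
    (k 1).natAbs ≤ ((k - p) 1).natAbs + (p 1).natAbs ∧
      ((k - p) 1).natAbs ≤ (k 1).natAbs + (p 1).natAbs := by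
  simp only [Pi.sub_apply]
  omega

/-- A bound of the weight difference that is symmetric in the two output frequencies reduces the
absolute flux to a one-sided sum. -/
theorem IsRealDivFree.absFlux_le_two_mul {v : FourierField} (hv : IsRealDivFree v)
    {w : ℕ → ℝ≥0} (F : ℕ → ℕ → ℕ → ℝ≥0∞)
    (h : ∀ x : (Fin 2 → ℤ) × (Fin 2 → ℤ), ‖weightDiff w x‖ₑ ≤
      F (x.1 1).natAbs ((x.1 - x.2) 1).natAbs (x.2 1).natAbs +
        F ((x.1 - x.2) 1).natAbs (x.1 1).natAbs (x.2 1).natAbs) :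
    absFlux w v ≤ 2 * ∑' x : (Fin 2 → ℤ) × (Fin 2 → ℤ),
      F (x.1 1).natAbs ((x.1 - x.2) 1).natAbs (x.2 1).natAbs * ‖triad v x‖ₑ := by
  have e : ∑' x : (Fin 2 → ℤ) × (Fin 2 → ℤ),
      F ((x.1 - x.2) 1).natAbs (x.1 1).natAbs (x.2 1).natAbs * ‖triad v x‖ₑ =
      ∑' x : (Fin 2 → ℤ) × (Fin 2 → ℤ),
      F (x.1 1).natAbs ((x.1 - x.2) 1).natAbs (x.2 1).natAbs * ‖triad v x‖ₑ := by
    rw [← reflectPair.tsum_eq]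
    refine tsum_congr fun x => ?_
    rw [hv.enorm_triad_reflectPair]
    have h1 : ((x.2 - x.1) 1).natAbs = ((x.1 - x.2) 1).natAbs := by
      simp only [Pi.sub_apply]; omega
    have h2 : ((x.2 - x.1 - x.2) 1).natAbs = (x.1 1).natAbs := by
      simp only [Pi.sub_apply]; omega
    simp only [reflectPair_apply, h1, h2]
  calc absFlux w v ≤ _ := ENNReal.tsum_le_tsum fun x => mul_le_mul_left (h x) _
    _ = _ := by
      simp only [add_mul, ENNReal.tsum_add]
      rw [e, two_mul]

/-- The product rule leaves two sums: either the full truncated symbol falls on the transporting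
frequency p, or one factor |p₂| does and min(|·|, N) falls on k - p. The trilinear estimate bounds
each by the H^{1,1} norm, the truncated energy and its horizontal dissipation, with a constant
independent of N. -/
theorem IsRealDivFree.absFlux_truncWeight_sq_le {v : FourierField} (hv : IsRealDivFree v) (N : ℕ) :
    absFlux (truncWeight N) v ^ 2 ≤ 28672 * energyOneOne v *
      (weightedEnergy (fun k => verticalWeight (truncWeight N) k * (1 + horiz k) ^ 2) v) *
        weightedEnergy (verticalWeight (truncWeight N)) v := by
  have h := hv.absFlux_le_two_mul (w := truncWeight N)
    (fun a b c => 2 * ((2 * (c * min c N : ℕ) + 2 * (c * (min b N : ℕ))) * (a * min a N : ℕ)))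
    (fun x => by
      have h1 := mul_min_le_of_le_add (N := N) (natAbs_vert_triangle x.1 x.2).1
      have h2 := mul_min_le_of_le_add (N := N) (natAbs_vert_triangle x.1 x.2).2
      have := enorm_sub_sq_le (a := ((x.1 1).natAbs * min (x.1 1).natAbs N : ℕ))
        (b := (((x.1 - x.2) 1).natAbs * min ((x.1 - x.2) 1).natAbs N : ℕ))
        (c := (2 * ((x.2 1).natAbs * min (x.2 1).natAbs N) +
          2 * ((x.2 1).natAbs * min ((x.1 - x.2) 1).natAbs N) : ℕ))
        (d := (2 * ((x.2 1).natAbs * min (x.2 1).natAbs N) +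
          2 * ((x.2 1).natAbs * min (x.1 1).natAbs N) : ℕ))
        (by rw [← Nat.cast_add, Nat.cast_le, ← add_assoc]; exact h1)
        (by rw [← Nat.cast_add, Nat.cast_le, ← add_assoc]; exact h2)
      rw [weightDiff, truncWeight, truncWeight]
      refine this.trans (le_of_eq ?_)
      generalize min (x.1 1).natAbs N = m₁
      generalize min ((x.1 - x.2) 1).natAbs N = m₂
      generalize min (x.2 1).natAbs N = m₃
      push_cast
      ring)
  set X1 := ∑' x : (Fin 2 → ℤ) × (Fin 2 → ℤ),
    truncSymbol N x.2 * 1 * truncSymbol N x.1 * ‖triad v x‖ₑ with hX1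
  set X2 := ∑' x : (Fin 2 → ℤ) × (Fin 2 → ℤ),
    vert x.2 * vertMin N (x.1 - x.2) * truncSymbol N x.1 * ‖triad v x‖ₑ with hX2
  have e : ∑' x : (Fin 2 → ℤ) × (Fin 2 → ℤ), 2 * ((2 * ((x.2 1).natAbs * min (x.2 1).natAbs N : ℕ) +
      2 * ((x.2 1).natAbs * (min ((x.1 - x.2) 1).natAbs N : ℕ))) *
      ((x.1 1).natAbs * min (x.1 1).natAbs N : ℕ)) * ‖triad v x‖ₑ = 4 * (X1 + X2) := by
    rw [hX1, hX2, ← ENNReal.tsum_add, ← ENNReal.tsum_mul_left]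
    refine tsum_congr fun x => ?_
    simp only [truncSymbol, vert, vertMin]
    ring
  rw [e] at h
  set P := weightedEnergy (fun k => verticalWeight (truncWeight N) k * (1 + horiz k) ^ 2) v
  set E := weightedEnergy (verticalWeight (truncWeight N)) v with hE
  set Y := energyOneOne v
  have hE' : weightedEnergy (fun k => truncSymbol N k ^ 2) v = E := by
    simp only [hE, ← verticalWeight_truncWeight]
  have h1 : X1 ^ 2 ≤ 32 * P * (Y + Y) * E := by
    have := hv.tsum_mul_triad_sq_le (truncSymbol N) (fun _ => 1) (truncSymbol N)
    rw [hE'] at this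
    refine this.trans ?_
    gcongr
    · refine weightedEnergy_mono (fun k => le_of_eq ?_) v
      rw [verticalWeight_truncWeight]; ring
    · refine weightedEnergy_mono (fun k => ?_) v
      rw [mul_one, mul_comm]
      gcongr
      exact le_add_self
    · refine weightedEnergy_mono (fun k => ?_) v
      rw [mul_one]
      gcongr
      exact le_add_self
  have h2 : X2 ^ 2 ≤ 32 * Y * (4 * P + P) * E := by
    have := hv.tsum_mul_triad_sq_le vert (vertMin N) (truncSymbol N)
    rw [hE'] at this
    refine this.trans ?_
    gcongr
    · refine weightedEnergy_mono (fun k => ?_) v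
      gcongr
      exact le_add_self
    · rw [← weightedEnergy_const_mul]
      refine weightedEnergy_mono (fun k => ?_) v
      -- For a nonzero vertical frequency, 1 + |k₂| ≤ 2|k₂|; for a zero one both sides vanish.
      have hm : (1 + vert k) * vertMin N k ≤ 2 * truncSymbol N k := by
        simp only [vert, vertMin, truncSymbol]
        rcases Nat.eq_zero_or_pos (k 1).natAbs with h0 | h0
        · simp [h0]
        · norm_cast
          rw [← mul_assoc]
          gcongr
          omega
      calc ((1 + vert k) * vertMin N k * horiz k) ^ 2
          ≤ (2 * truncSymbol N k * (1 + horiz k)) ^ 2 := by gcongr; exact le_add_self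
        _ = _ := by rw [verticalWeight_truncWeight]; ring
    · refine weightedEnergy_mono (fun k => le_of_eq ?_) v
      rw [verticalWeight_truncWeight]
      simp only [vertMin, vert, truncSymbol]
      push_cast
      ring
  calc absFlux (truncWeight N) v ^ 2 ≤ (2 * (4 * (X1 + X2))) ^ 2 := by gcongr
    _ = 64 * (X1 + X2) ^ 2 := by ring
    _ ≤ 64 * (2 * (X1 ^ 2 + X2 ^ 2)) := by gcongr; exact add_sq_le_two_mul _ _
    _ ≤ 64 * (2 * (32 * P * (Y + Y) * E + 32 * Y * (4 * P + P) * E)) := by gcongr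
    _ = 28672 * Y * P * E := by ring
-- Cancellation in the first order vertical flux
/-- The first order vertical weight `|n|²`. -/
def sqWeight (n : ℕ) : ℝ≥0 := (n : ℝ≥0) ^ 2

theorem verticalWeight_sqWeight (k : Fin 2 → ℤ) : verticalWeight sqWeight k = vert k ^ 2 := by
  simp [verticalWeight, sqWeight, vert]

theorem weightDiff_sqWeight (x : (Fin 2 → ℤ) × (Fin 2 → ℤ)) :
    (weightDiff sqWeight x : ℂ) = x.2 1 * x.1 1 + x.2 1 * (x.1 - x.2) 1 := by
  have h : ∀ n : ℤ, (n.natAbs : ℂ) ^ 2 = (n : ℂ) ^ 2 := fun n => by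
    have := congrArg (Int.cast : ℤ → ℂ) (Int.natAbs_sq n)
    push_cast at this
    simpa using this
  simp only [weightDiff, sqWeight]
  push_cast
  simp only [h, Pi.sub_apply]
  push_cast
  ring

namespace IsRealDivFree

variable {v : FourierField}

theorem tsum_vert_trilinear_sq_le (hv : IsRealDivFree v) :
    (∑' x : (Fin 2 → ℤ) × (Fin 2 → ℤ), vert x.2 * 1 * vert x.1 *
        ((‖v x.2 0‖ₑ * horiz (x.1 - x.2) + ‖v x.2 1‖ₑ * vert (x.1 - x.2)) *
      ‖v (x.1 - x.2)‖ₑ * ‖v x.1‖ₑ)) ^ 2 ≤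
      64 * energyOneOne v * energyOneOne v * weightedEnergy (verticalWeight sqWeight) v := by
  simp only [funext verticalWeight_sqWeight]
  refine (hv.tsum_triad_sq_le vert (fun _ => 1) vert).trans ?_
  calc _ ≤ 32 * energyOneOne v * (energyOneOne v + energyOneOne v) *
        weightedEnergy (fun k => vert k ^ 2) v := by
        gcongr
        · refine weightedEnergy_mono (fun k => ?_) v
          gcongr
          exact le_add_self
        · refine weightedEnergy_mono (fun k => ?_) v
          rw [mul_one, mul_comm]
          gcongr
          exact le_add_self
        · refine weightedEnergy_mono (fun k => ?_) v
          rw [mul_one]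
          gcongr
          exact le_add_self
    _ = _ := by ring

theorem tsum_vert_mul_triad_sq_le (hv : IsRealDivFree v) :
    (∑' x : (Fin 2 → ℤ) × (Fin 2 → ℤ), vert x.2 * 1 * vert x.1 * ‖triad v x‖ₑ) ^ 2 ≤
      64 * energyOneOne v * energyOneOne v * weightedEnergy (verticalWeight sqWeight) v := by
  refine le_trans ?_ hv.tsum_vert_trilinear_sq_le
  refine pow_le_pow_left' (ENNReal.tsum_le_tsum fun x => ?_) 2
  gcongr
  exact hv.enorm_triad_le x

/-- A qualitative bound: it gives integrability of the flux in time but, containing the full H^{1,1}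
norm squared, it cannot be absorbed by the dissipation. The quantitative bound comes from
`flux_sqWeight_eq`. -/
theorem absFlux_sqWeight_sq_le (hv : IsRealDivFree v) :
    absFlux sqWeight v ^ 2 ≤
      1024 * energyOneOne v * energyOneOne v * weightedEnergy (verticalWeight sqWeight) v := by
  have h := hv.absFlux_le_two_mul (w := sqWeight) (fun a _ c => 2 * ((c : ℝ≥0∞) * a)) (fun x => by
    have ht := natAbs_vert_triangle x.1 x.2
    have := enorm_sub_sq_le (a := (x.1 1).natAbs) (b := ((x.1 - x.2) 1).natAbs)
      (c := (x.2 1).natAbs) (d := (x.2 1).natAbs) (by exact_mod_cast ht.1)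
      (by exact_mod_cast ht.2)
    rw [weightDiff, sqWeight, sqWeight]
    simpa using this)
  have e : ∑' x : (Fin 2 → ℤ) × (Fin 2 → ℤ),
      2 * (((x.2 1).natAbs : ℝ≥0∞) * (x.1 1).natAbs) * ‖triad v x‖ₑ =
      2 * ∑' x : (Fin 2 → ℤ) × (Fin 2 → ℤ), vert x.2 * 1 * vert x.1 * ‖triad v x‖ₑ := by
    rw [← ENNReal.tsum_mul_left]
    refine tsum_congr fun x => ?_
    simp only [vert]
    ring
  rw [e] at h
  refine (pow_le_pow_left' h 2).trans ?_
  calc _ = 16 * (∑' x : (Fin 2 → ℤ) × (Fin 2 → ℤ), vert x.2 * 1 * vert x.1 * ‖triad v x‖ₑ) ^ 2 := by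
        ring
    _ ≤ _ := mul_le_mul_right hv.tsum_vert_mul_triad_sq_le _
    _ = _ := by ring

/-- The part of the vertical energy flux that survives the cancellations. -/
def fluxCore (v : FourierField) (x : (Fin 2 → ℤ) × (Fin 2 → ℤ)) : ℂ :=
  (x.1 0 * (starRingEnd ℂ) (v x.1 0)) * (x.2 1 * v x.2 1) * ((x.1 - x.2) 0 * v (x.1 - x.2) 0) -
    (x.1 0 * (starRingEnd ℂ) (v x.1 0)) * (x.2 1 * v x.2 0) * ((x.1 - x.2) 0 * v (x.1 - x.2) 1)

/-- By reflection the flux is twice ∑ p₂k₂ triad, the form of ⟨∂₂u·∇u, ∂₂u⟩. The products of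
horizontal output components sum to zero, as in ∫ (∂₂u₁)²(∂₁u₁ + ∂₂u₂) = 0. In the other products
the divergence relation at k and at k - p produces two horizontal derivatives. The finiteness
hypotheses make each regrouped series absolutely summable. -/
theorem flux_sqWeight_eq (hv : IsRealDivFree v) (hY : energyOneOne v ≠ ⊤) 
    (hE : weightedEnergy (verticalWeight sqWeight) v ≠ ⊤) :
    flux sqWeight v = 2 * ∑' x, fluxCore v x := by
  have hfin : 64 * energyOneOne v * energyOneOne v * weightedEnergy (verticalWeight sqWeight) v ≠ ⊤ := by
    finiteness
  have hfin2 : ∀ {X : ℝ≥0∞}, X ^ 2 ≤ 64 * energyOneOne v * energyOneOne v * weightedEnergy (verticalWeight sqWeight) v → X ≠ ⊤ := by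
    rintro X hX rfl
    exact hfin (top_le_iff.1 (by simpa using hX))
  have hW := hfin2 hv.tsum_vert_mul_triad_sq_le
  have hS : Summable fun x : (Fin 2 → ℤ) × (Fin 2 → ℤ) => (x.2 1 * x.1 1 : ℂ) * triad v x := by
    refine Summable.of_enorm ?_
    convert hW using 3 with x
    rw [enorm_mul, enorm_mul, enorm_intCast, enorm_intCast, vert, vert, mul_one]
  have hS' : Summable fun x : (Fin 2 → ℤ) × (Fin 2 → ℤ) =>
      (x.2 1 * (x.1 - x.2) 1 : ℂ) * triad v x := by
    refine (reflectPair.summable_iff.2 hS).congr fun x => ?_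
    rw [Function.comp, hv.triad_reflectPair]
    simp only [reflectPair_apply, Pi.sub_apply]
    push_cast
    ring
  have h1 : flux sqWeight v = 2 * ∑' x : (Fin 2 → ℤ) × (Fin 2 → ℤ), (x.2 1 * x.1 1 : ℂ) * triad v x := by
    have : ∑' x : (Fin 2 → ℤ) × (Fin 2 → ℤ), (x.2 1 * (x.1 - x.2) 1 : ℂ) * triad v x =
        ∑' x : (Fin 2 → ℤ) × (Fin 2 → ℤ), (x.2 1 * x.1 1 : ℂ) * triad v x := by
      rw [← reflectPair.tsum_eq fun x : (Fin 2 → ℤ) × (Fin 2 → ℤ) => (x.2 1 * x.1 1 : ℂ) * triad v x]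
      refine tsum_congr fun x => ?_
      rw [hv.triad_reflectPair]
      simp only [reflectPair_apply, Pi.sub_apply]
      push_cast
      ring
    simp only [flux, weightDiff_sqWeight, add_mul]
    rw [hS.tsum_add hS', this]
    ring
  let T1 : (Fin 2 → ℤ) × (Fin 2 → ℤ) → ℂ := fun x =>
    (x.1 1 * (starRingEnd ℂ) (v x.1 0)) * (x.2 1 * v x.2 0) * ((x.1 - x.2) 0 * v (x.1 - x.2) 0)
  let T2 : (Fin 2 → ℤ) × (Fin 2 → ℤ) → ℂ := fun x =>
    (x.1 1 * (starRingEnd ℂ) (v x.1 0)) * (x.2 1 * v x.2 1) * ((x.1 - x.2) 1 * v (x.1 - x.2) 0)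
  have hT : Summable T1 ∧ Summable T2 := by
    have hb := hfin2 (X := ∑' x : (Fin 2 → ℤ) × (Fin 2 → ℤ), vert x.2 * 1 * vert x.1 *
        ((‖v x.2 0‖ₑ * horiz (x.1 - x.2) + ‖v x.2 1‖ₑ * vert (x.1 - x.2)) *
      ‖v (x.1 - x.2)‖ₑ * ‖v x.1‖ₑ)) hv.tsum_vert_trilinear_sq_le
    constructor
    · refine Summable.of_enorm (ne_top_of_le_ne_top hb (ENNReal.tsum_le_tsum fun x => ?_))
      simp only [T1, enorm_mul, enorm_intCast, RCLike.enorm_conj]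
      calc _ = vert x.2 * 1 * vert x.1 * (‖v x.2 0‖ₑ * horiz (x.1 - x.2) *
          ‖v (x.1 - x.2) 0‖ₑ * ‖v x.1 0‖ₑ) := by simp only [vert, horiz]; ring
        _ ≤ _ := by
          gcongr
          · exact le_self_add
          · exact enorm_apply_le _ _
          · exact enorm_apply_le _ _
    · refine Summable.of_enorm (ne_top_of_le_ne_top hb (ENNReal.tsum_le_tsum fun x => ?_))
      simp only [T2, enorm_mul, enorm_intCast, RCLike.enorm_conj]
      calc _ = vert x.2 * 1 * vert x.1 * (‖v x.2 1‖ₑ * vert (x.1 - x.2) *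
          ‖v (x.1 - x.2) 0‖ₑ * ‖v x.1 0‖ₑ) := by simp only [vert]; ring
        _ ≤ _ := by
          gcongr
          · exact le_add_self
          · exact enorm_apply_le _ _
          · exact enorm_apply_le _ _
  -- `T1 + T2` collects the horizontal output components. In the rest, the divergence relation at k
  -- turns k₂v₂ into -k₁v₁, and then the one at k - p does the same in the second product.
  have hdec : ∀ x, (x.2 1 * x.1 1 : ℂ) * triad v x = (T1 x + T2 x) + fluxCore v x := by
    intro x
    have hk : (x.1 0 : ℂ) * (starRingEnd ℂ) (v x.1 0) + x.1 1 * (starRingEnd ℂ) (v x.1 1) = 0 := by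
      have := congrArg (starRingEnd ℂ) (hv.div x.1)
      simpa using this
    have hq := hv.div (x.1 - x.2)
    rw [hv.triad_eq]
    simp only [T1, T2, fluxCore, inner_eq]
    linear_combination ((x.2 1 : ℂ) * v x.2 0 * ((x.1 - x.2) 0 * v (x.1 - x.2) 1) + 
      (x.2 1 : ℂ) * v x.2 1 * ((x.1 - x.2) 1 * v (x.1 - x.2) 1)) * hk - 
      (x.1 0 : ℂ) * (starRingEnd ℂ) (v x.1 0) * (x.2 1 * v x.2 1) * hq
  have hC : Summable (fluxCore v) := by
    refine (hS.sub (hT.1.add hT.2)).congr fun x => ?_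
    rw [hdec]
    ring
  -- Exchanging p and k - p in `T2` makes it the negative of `T1`, by the divergence relation at k -
  -- p.
  have hzero : ∑' x, T1 x + ∑' x, T2 x = 0 := by
    have hs : Summable fun x => T2 (swapPair x) := swapPair.summable_iff.2 hT.2
    rw [← swapPair.tsum_eq T2, ← hT.1.tsum_add hs]
    refine (tsum_congr fun x => ?_).trans tsum_zero
    have hq := hv.div (x.1 - x.2)
    simp only [T1, T2, swapPair_apply, sub_sub_cancel]
    linear_combination (x.1 1 : ℂ) * (starRingEnd ℂ) (v x.1 0) * (x.2 1 * v x.2 0) * hq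
  rw [h1]
  simp only [hdec]
  rw [(hT.1.add hT.2).tsum_add hC, hT.1.tsum_add hT.2, hzero, zero_add]

/-- The two factors with a horizontal derivative receive the weights of the trilinear estimate, and
the one with a vertical derivative is measured in L². The free parameter `l` balances ‖∂₁u‖² against
‖∂₁∂₂u‖², so that the latter can be given a small coefficient. -/
theorem tsum_enorm_fluxCore_sq_le (hv : IsRealDivFree v) {l : ℝ≥0} (hl : 1 ≤ l) :
    (∑' x, ‖fluxCore v x‖ₑ) ^ 2 ≤ (16 / l) ^ 2 *
      (l ^ 2 * weightedEnergy (fun k => horiz k ^ 2) v +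
        weightedEnergy (fun k => horiz k ^ 2 * verticalWeight sqWeight k) v) ^ 2 *
      weightedEnergy (verticalWeight sqWeight) v := by
  have h := tsum_trilinear_sq_le hl
    (fun k => horiz k * ‖v k 0‖ₑ) (fun k => horiz k * ‖v k‖ₑ) (fun k => vert k * ‖v k‖ₑ)
    (fun x : (Fin 2 → ℤ) × (Fin 2 → ℤ) => x.1) (fun x => x.1 - x.2) (fun x => x.2)
    (by
      rintro ⟨k, p⟩ ⟨k', p'⟩ h
      simp only [Prod.mk.injEq] at h ⊢
      obtain ⟨rfl, h⟩ := h
      exact ⟨rfl, sub_right_injective h⟩) (by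
      rintro ⟨k, p⟩ ⟨k', p'⟩ h
      simp only [Prod.mk.injEq] at h ⊢
      obtain ⟨rfl, h0, h1⟩ := h
      refine ⟨funext fun i => ?_, rfl⟩
      fin_cases i
      · exact h0
      · simpa using h1)
  have hX : ∑' x, ‖fluxCore v x‖ₑ ≤ 2 * ∑' x : (Fin 2 → ℤ) × (Fin 2 → ℤ), horiz x.1 * ‖v x.1 0‖ₑ *
      (horiz (x.1 - x.2) * ‖v (x.1 - x.2)‖ₑ) * (vert x.2 * ‖v x.2‖ₑ) := by
    rw [← ENNReal.tsum_mul_left]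
    refine ENNReal.tsum_le_tsum fun x => ?_
    rw [fluxCore]
    refine enorm_sub_le.trans ?_
    simp only [enorm_mul, enorm_intCast, RCLike.enorm_conj]
    rw [two_mul]
    refine add_le_add ?_ ?_
    · rw [mul_assoc, mul_comm (_ * _) (_ * ‖v (x.1 - x.2) 0‖ₑ), ← mul_assoc]
      simp only [horiz, vert]
      gcongr <;> exact enorm_apply_le _ _
    · rw [mul_assoc, mul_comm (_ * _) (_ * ‖v (x.1 - x.2) 1‖ₑ), ← mul_assoc]
      simp only [horiz, vert]
      gcongr <;> exact enorm_apply_le _ _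
  set Z := l ^ 2 * weightedEnergy (fun k => horiz k ^ 2) v +
        weightedEnergy (fun k => horiz k ^ 2 * verticalWeight sqWeight k) v with hZ
  have e : 2 * Z = weightedEnergy (fun k => 2 * ((l * horiz k) ^ 2 + (horiz k * vert k) ^ 2)) v := by
    rw [hZ, weightedEnergy_const_mul, weightedEnergy_add, ← weightedEnergy_const_mul]
    simp only [mul_pow, verticalWeight_sqWeight]
  -- No second horizontal derivative arises: k₁²|v₁| = |k₁k₂||v₂| by incompressibility. This is why
  -- this factor carries the component `v k 0` and not the full vector.
  have hA : ∑' k, (((l : ℝ≥0∞) + ((k 0).natAbs : ℝ≥0∞)) * (horiz k * ‖v k 0‖ₑ)) ^ 2 ≤ 2 * Z := by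
    rw [e]
    refine ENNReal.tsum_le_tsum fun k => ?_
    calc (((l : ℝ≥0∞) + ((k 0).natAbs : ℝ≥0∞)) * (horiz k * ‖v k 0‖ₑ)) ^ 2
        = (l * (horiz k * ‖v k 0‖ₑ) + horiz k * (vert k * ‖v k 1‖ₑ)) ^ 2 := by
          rw [hv.vert_mul_enorm, horiz]; ring
      _ ≤ (l * (horiz k * ‖v k‖ₑ) + horiz k * (vert k * ‖v k‖ₑ)) ^ 2 := by
          gcongr <;> exact enorm_apply_le _ _
      _ ≤ 2 * ((l * (horiz k * ‖v k‖ₑ)) ^ 2 + (horiz k * (vert k * ‖v k‖ₑ)) ^ 2) :=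
          add_sq_le_two_mul _ _
      _ = _ := by ring
  have hB : ∑' k, (((l : ℝ≥0∞) + ((k 1).natAbs : ℝ≥0∞)) * (horiz k * ‖v k‖ₑ)) ^ 2 ≤ 2 * Z := by
    rw [e]
    refine ENNReal.tsum_le_tsum fun k => ?_
    calc (((l : ℝ≥0∞) + ((k 1).natAbs : ℝ≥0∞)) * (horiz k * ‖v k‖ₑ)) ^ 2
        = (l * (horiz k * ‖v k‖ₑ) + horiz k * (vert k * ‖v k‖ₑ)) ^ 2 := by
          rw [vert]; ring
      _ ≤ 2 * ((l * (horiz k * ‖v k‖ₑ)) ^ 2 + (horiz k * (vert k * ‖v k‖ₑ)) ^ 2) :=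
          add_sq_le_two_mul _ _
      _ = _ := by ring
  have hC : ∑' k, (vert k * ‖v k‖ₑ) ^ 2 = weightedEnergy (verticalWeight sqWeight) v := by
    refine tsum_congr fun k => ?_
    rw [mul_pow, verticalWeight_sqWeight]
  rw [hC] at h
  have h' := h.trans (mul_le_mul_left (mul_le_mul' (mul_le_mul_right hA _) hB) _)
  refine (pow_le_pow_left' hX 2).trans ?_
  rw [mul_pow]
  refine (mul_le_mul_right h' _).trans (le_of_eq ?_)
  rw [ENNReal.div_eq_inv_mul, ENNReal.div_eq_inv_mul]
  ring

/-- The vertical energy flux is controlled by the dissipation, up to a multiple of the energy whose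
coefficient is integrable in time by the basic energy inequality. -/
theorem enorm_flux_sqWeight_le (hv : IsRealDivFree v) (hY : energyOneOne v ≠ ⊤) 
    (hE : weightedEnergy (verticalWeight sqWeight) v ≠ ⊤) :
    ‖flux sqWeight v‖ₑ ≤ weightedEnergy (fun k => horiz k ^ 2 * verticalWeight sqWeight k) v +
      2048 * weightedEnergy (fun k => horiz k ^ 2) v *
        (1 + weightedEnergy (verticalWeight sqWeight) v) := by
  rw [hv.flux_sqWeight_eq hY hE]
  generalize hb : weightedEnergy (verticalWeight sqWeight) v = B at *
  lift B to ℝ≥0 using hE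
  set b := NNReal.sqrt B with hbdef
  have hbB : b ^ 2 = B := NNReal.sq_sqrt B
  -- This choice of `l`, with b = ‖∂₂v‖, makes the coefficient 32b / l of the dissipation at most 1,
  -- while 32lb stays below 2048(1 + b²).
  have hl : 1 ≤ 1 + 32 * b := le_self_add
  have h := hv.tsum_enorm_fluxCore_sq_le hl
  rw [hb] at h
  set l := 1 + 32 * b with hldef
  set a := weightedEnergy (fun k => horiz k ^ 2) v
  set c := weightedEnergy (fun k => horiz k ^ 2 * verticalWeight sqWeight k) v
  have hl0 : l ≠ 0 := (lt_of_lt_of_le one_pos hl).ne'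
  have h2 : ∑' x, ‖fluxCore v x‖ₑ ≤ 16 / l * (l ^ 2 * a + c) * b := by
    rw [← hbB, ENNReal.coe_pow, ← mul_pow, ← mul_pow] at h
    exact (ENNReal.pow_le_pow_left_iff two_ne_zero).1 h
  have h3 : (32 : ℝ≥0∞) / l * l = 32 := ENNReal.div_mul_cancel (by simpa using hl0) (by simp)
  calc ‖2 * ∑' x, fluxCore v x‖ₑ ≤ 2 * ∑' x, ‖fluxCore v x‖ₑ := by
        rw [enorm_mul]
        gcongr
        · simp [← ofReal_norm]
        · exact enorm_tsum_le_tsum_enorm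
    _ ≤ 2 * (16 / l * (l ^ 2 * a + c) * b) := by gcongr
    _ = (32 / l * l) * l * b * a + (32 / l) * b * c := by
        rw [ENNReal.div_eq_inv_mul, ENNReal.div_eq_inv_mul]
        ring
    _ ≤ 2048 * a * (1 + B) + 1 * c := by
        rw [h3]
        gcongr ?_ + ?_ * c
        · have : 32 * l * b ≤ 2048 * (1 + B) := by
            rw [← hbB, hldef, ← NNReal.coe_le_coe]
            push_cast
            nlinarith [sq_nonneg ((b : ℝ) - 1), b.2]
          calc 32 * (l : ℝ≥0∞) * b * a ≤ 2048 * (1 + B) * a := by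
                refine mul_le_mul_left ?_ a
                exact_mod_cast this
            _ = _ := by ring
        · rw [ENNReal.div_eq_inv_mul, mul_assoc, ← ENNReal.div_eq_inv_mul]
          refine ENNReal.div_le_of_le_mul ?_
          rw [one_mul]
          exact_mod_cast (le_add_self : 32 * b ≤ l)
    _ = _ := by ring

end IsRealDivFree
-- Young's inequality applied to `absFlux_truncWeight_sq_le`: after squaring, the right side
-- contains all the required products. The coefficient of the dissipation is 1, half of what
-- viscosity provides.
theorem IsRealDivFree.absFlux_truncWeight_le {v : FourierField} (hv : IsRealDivFree v) (N : ℕ) :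
    absFlux (truncWeight N) v ≤
      weightedEnergy (fun k => horiz k ^ 2 * verticalWeight (truncWeight N) k) v +
        (1 + 57344 * energyOneOne v) * weightedEnergy (verticalWeight (truncWeight N)) v := by
  set E := weightedEnergy (verticalWeight (truncWeight N)) v with hE
  set F := weightedEnergy (fun k => horiz k ^ 2 * verticalWeight (truncWeight N) k) v with hF
  set Y := energyOneOne v
  have hP : weightedEnergy (fun k => verticalWeight (truncWeight N) k * (1 + horiz k) ^ 2) v ≤
      2 * (E + F) := by
    rw [hE, hF, ← weightedEnergy_add, ← weightedEnergy_const_mul]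
    refine weightedEnergy_mono (fun k => ?_) v
    calc _ ≤ verticalWeight (truncWeight N) k * (2 * (1 ^ 2 + horiz k ^ 2)) := by
          gcongr; exact add_sq_le_two_mul _ _
      _ = _ := by ring
  rw [← ENNReal.pow_le_pow_left_iff (two_ne_zero)]
  calc absFlux (truncWeight N) v ^ 2 ≤ 28672 * Y * (2 * (E + F)) * E :=
        (hv.absFlux_truncWeight_sq_le N).trans (by gcongr)
    _ = 57344 * Y * E ^ 2 + 57344 * Y * E * F := by ring
    _ ≤ (57344 * Y * E ^ 2 + 57344 * Y * E * F) +
        (F ^ 2 + E ^ 2 + 2 * E * F + 57344 * Y * E * F + 57344 * Y * E ^ 2 +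
          (57344 * Y * E) ^ 2) := le_self_add
    _ = _ := by ring

/-! ### Energy balance of a single mode -/

/-- If `a` is a primitive of `g`, then `a²` is a primitive of `2 a g`. -/
theorem sq_eq_of_eq_integral {T a₀ : ℝ} {a g : ℝ → ℝ} (hg : IntervalIntegrable g volume 0 T)
    (ha : ∀ t ∈ Icc 0 T, a t = a₀ + ∫ s in (0 : ℝ)..t, g s) :
    ∀ t ∈ Icc 0 T, a t ^ 2 = a₀ ^ 2 + ∫ s in (0 : ℝ)..t, 2 * (a s * g s) := by
  intro t ht
  have hT : (0 : ℝ) ≤ T := ht.1.trans ht.2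
  have hgt : IntervalIntegrable g volume 0 t := hg.mono_set (by
    rw [uIcc_of_le ht.1, uIcc_of_le hT]; exact Icc_subset_Icc_right ht.2)
  let A : ℝ → ℝ := fun x => ∫ s in (0 : ℝ)..x, g s
  -- The primitive of an integrable function is absolutely continuous, so integration by parts is
  -- available although the derivative exists only almost everywhere.
  have hA : AbsolutelyContinuousOnInterval A 0 t :=
    hgt.absolutelyContinuousOnInterval_intervalIntegral left_mem_uIcc
  have h1 := hA.integral_deriv_mul_eq_sub hA
  have hd : ∀ᵐ x, x ∈ uIoc 0 t → deriv A x = g x := by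
    filter_upwards [hgt.ae_hasDerivAt_integral] with x hx hx'
    exact (hx (uIoc_subset_uIcc hx') 0 left_mem_uIcc).deriv
  have h2 : ∫ s in (0 : ℝ)..t, 2 * (A s * g s) = A t ^ 2 := by
    rw [sq, show A t * A t = A t * A t - A 0 * A 0 by simp [A], ← h1]
    refine intervalIntegral.integral_congr_ae ?_
    filter_upwards [hd] with x hx hx'
    rw [hx hx']
    ring
  have hAg : IntervalIntegrable (fun s => A s * g s) volume 0 t :=
    hgt.continuousOn_mul hA.continuousOn
  have h3 : ∫ s in (0 : ℝ)..t, 2 * (a s * g s) =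
      ∫ s in (0 : ℝ)..t, (2 * a₀ * g s + 2 * (A s * g s)) := by
    refine intervalIntegral.integral_congr fun s hs => ?_
    rw [uIcc_of_le ht.1] at hs
    rw [ha s ⟨hs.1, hs.2.trans ht.2⟩]
    ring
  rw [h3, intervalIntegral.integral_add (hgt.const_mul _) (hAg.const_mul _), h2,
    intervalIntegral.integral_const_mul, ha t ht]
  ring

/-- The `j`-th component of the convection term `∑_p (v_p · k) v_{k-p}`, without the factor `i`. -/
def convectionCoeff (v : FourierField) (k : Fin 2 → ℤ) (j : Fin 2) : ℂ :=
  ∑' p, (v p 0 * k 0 + v p 1 * k 1) * v (k - p) j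

/-- A solution of the anisotropic Navier-Stokes equation, described by its Fourier coefficients. -/
structure IsFourierSolution (T : ℝ) (c : ℝ → FourierField) : Prop where
  realDivFree : ∀ s, IsRealDivFree (c s)
  continuous : ∀ k i, Continuous fun s => c s k i
  bounded : ∃ M : ℝ≥0, ∀ s, weightedEnergy (fun k => (1 + vert k) ^ 2) (c s) ≤ M
  integrable : ∫⁻ s in Ioc 0 T, energyOneOne (c s) ≠ ⊤
  equation : ∀ (k : Fin 2 → ℤ) (ξ : Fin 2 → ℝ), ξ 0 * k 0 + ξ 1 * k 1 = 0 → ∀ t ∈ Icc 0 T,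
    ξ 0 * c t k 0 + ξ 1 * c t k 1 = ξ 0 * c 0 k 0 + ξ 1 * c 0 k 1 +
      ∫ s in (0 : ℝ)..t, (-((k 0 : ℂ) ^ 2 * (ξ 0 * c s k 0 + ξ 1 * c s k 1)) -
        Complex.I * (ξ 0 * convectionCoeff (c s) k 0 + ξ 1 * convectionCoeff (c s) k 1))

theorem tsum_enorm_mul_enorm_sub_le (v : FourierField) (k : Fin 2 → ℤ) :
    ∑' p, ‖v p‖ₑ * ‖v (k - p)‖ₑ ≤ weightedEnergy (fun _ => 1) v := by
  have h := tsum_mul_sq_le (fun p => ‖v p‖ₑ) (fun p => ‖v (k - p)‖ₑ)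
  rw [show ∑' p, ‖v (k - p)‖ₑ ^ 2 = ∑' p, ‖v p‖ₑ ^ 2 from
    (Equiv.subLeft k).tsum_eq (fun p => ‖v p‖ₑ ^ 2), ← sq, ENNReal.pow_le_pow_left_iff (two_ne_zero)] at h
  simpa [weightedEnergy] using h

theorem enorm_convection_term_le (v : FourierField) (k p : Fin 2 → ℤ) (j : Fin 2) :
    ‖(v p 0 * k 0 + v p 1 * k 1) * v (k - p) j‖ₑ ≤
      (horiz k + vert k) * (‖v p‖ₑ * ‖v (k - p)‖ₑ) := by
  rw [enorm_mul, ← mul_assoc]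
  gcongr
  · refine (enorm_add_le _ _).trans ?_
    rw [enorm_mul, enorm_mul, enorm_intCast, enorm_intCast, add_mul, mul_comm, mul_comm ‖v p 1‖ₑ]
    simp only [horiz, vert]
    gcongr <;> exact enorm_apply_le _ _
  · exact enorm_apply_le _ _

theorem enorm_convectionCoeff_le (v : FourierField) (k : Fin 2 → ℤ) (j : Fin 2) :
    ‖convectionCoeff v k j‖ₑ ≤ (horiz k + vert k) * weightedEnergy (fun _ => 1) v := by
  refine enorm_tsum_le_tsum_enorm.trans ?_
  refine (ENNReal.tsum_le_tsum fun p => enorm_convection_term_le v k p j).trans ?_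
  rw [ENNReal.tsum_mul_left]
  gcongr
  exact tsum_enorm_mul_enorm_sub_le v k

theorem horiz_ne_top (k : Fin 2 → ℤ) : horiz k ≠ ⊤ := ENNReal.natCast_ne_top _

theorem vert_ne_top (k : Fin 2 → ℤ) : vert k ≠ ⊤ := ENNReal.natCast_ne_top _

theorem summable_convection {v : FourierField} (hv : weightedEnergy (fun _ => 1) v ≠ ⊤)
    (k : Fin 2 → ℤ) (j : Fin 2) :
    Summable fun p => (v p 0 * k 0 + v p 1 * k 1) * v (k - p) j := by
  refine Summable.of_enorm (ne_top_of_le_ne_top ?_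
    (ENNReal.tsum_le_tsum fun p => enorm_convection_term_le v k p j))
  rw [ENNReal.tsum_mul_left]
  exact ENNReal.mul_ne_top (ENNReal.add_ne_top.2 ⟨horiz_ne_top k, vert_ne_top k⟩)
    (ne_top_of_le_ne_top hv (tsum_enorm_mul_enorm_sub_le v k))

/-- The sum of the triads with output frequency `k`. -/
theorem tsum_triad_eq {v : FourierField} (hv : weightedEnergy (fun _ => 1) v ≠ ⊤)
    (k : Fin 2 → ℤ) :
    ∑' p, triad v (k, p) = convectionCoeff v k 0 * (starRingEnd ℂ) (v k 0) +
      convectionCoeff v k 1 * (starRingEnd ℂ) (v k 1) := by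
  rw [convectionCoeff, convectionCoeff, ← tsum_mul_right, ← tsum_mul_right,
    ← ((summable_convection hv k 0).mul_right _).tsum_add
      ((summable_convection hv k 1).mul_right _)]
  refine tsum_congr fun p => ?_
  simp only [triad, inner_eq]
  ring

theorem measurable_convectionCoeff {c : ℝ → FourierField}
    (hcont : ∀ k i, Continuous fun s => c s k i) (k : Fin 2 → ℤ) (j : Fin 2) :
    Measurable fun s => convectionCoeff (c s) k j := by
  refine Measurable.tsum fun p => Continuous.measurable ?_
  exact (((hcont p 0).mul continuous_const).add ((hcont p 1).mul continuous_const)).mul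
    (hcont _ j)

theorem intervalIntegrable_convectionCoeff {c : ℝ → FourierField}
    (hcont : ∀ k i, Continuous fun s => c s k i) {M : ℝ≥0}
    (hM : ∀ s, weightedEnergy (fun k => (1 + vert k) ^ 2) (c s) ≤ M) (k : Fin 2 → ℤ)
    (j : Fin 2) (a b : ℝ) : IntervalIntegrable (fun s => convectionCoeff (c s) k j) volume a b := by
  have hb : ∀ s, ‖convectionCoeff (c s) k j‖ ≤ ((horiz k + vert k) * M).toReal := by
    intro s
    rw [← toReal_enorm]
    refine ENNReal.toReal_mono (ENNReal.mul_ne_top (ENNReal.add_ne_top.2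
      ⟨horiz_ne_top k, vert_ne_top k⟩) ENNReal.coe_ne_top)
      ((enorm_convectionCoeff_le _ k j).trans ?_)
    gcongr
    exact (weightedEnergy_mono (fun k => one_le_pow₀ le_self_add) _).trans (hM s)
  refine (intervalIntegrable_const (c := ((horiz k + vert k) * M).toReal)).mono_fun
    (measurable_convectionCoeff hcont k j).aestronglyMeasurable ?_
  filter_upwards with s
  exact (hb s).trans (le_abs_self _)

namespace IsFourierSolution

variable {T : ℝ} {c : ℝ → FourierField}

theorem energy_one_ne_top (hc : IsFourierSolution T c) (s : ℝ) :
    weightedEnergy (fun _ => 1) (c s) ≠ ⊤ := by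
  obtain ⟨M, hM⟩ := hc.bounded
  refine ne_top_of_le_ne_top ENNReal.coe_ne_top ((weightedEnergy_mono (fun k => ?_) _).trans (hM s))
  exact one_le_pow₀ le_self_add

/-- The energy balance of a single Fourier mode. -/
theorem norm_sq_eq (hc : IsFourierSolution T c) (k : Fin 2 → ℤ) :
    ∀ t ∈ Icc 0 T, ‖c t k‖ ^ 2 = ‖c 0 k‖ ^ 2 + ∫ s in (0 : ℝ)..t,
      (2 * (∑' p, triad (c s) (k, p)).im - 2 * (k 0 : ℝ) ^ 2 * ‖c s k‖ ^ 2) := by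
  intro t ht
  obtain ⟨M, hM⟩ := hc.bounded
  let d : ℝ := (k 0 : ℝ) ^ 2 + (k 1 : ℝ) ^ 2
  -- The Leray projection at frequency k. Its rows are orthogonal to k, hence admissible as ξ in the
  -- equation. At k = 0 division by zero gives the identity, as it should.
  let P : Fin 2 → Fin 2 → ℝ := fun i j => (if i = j then 1 else 0) - k i * k j / d
  let g : Fin 2 → ℝ → ℂ := fun i s => -((k 0 : ℂ) ^ 2 * c s k i) -
    Complex.I * (P i 0 * convectionCoeff (c s) k 0 + P i 1 * convectionCoeff (c s) k 1)
  have hP : ∀ i, P i 0 * k 0 + P i 1 * k 1 = 0 := by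
    intro i
    by_cases hd : d = 0
    · have h0 : (k 0 : ℝ) = 0 := by nlinarith [sq_nonneg (k 0 : ℝ), sq_nonneg (k 1 : ℝ)]
      have h1 : (k 1 : ℝ) = 0 := by nlinarith [sq_nonneg (k 0 : ℝ), sq_nonneg (k 1 : ℝ)]
      simp [h0, h1]
    · have : (k 0 : ℝ) ^ 2 + (k 1 : ℝ) ^ 2 = d := rfl
      have hk : (k 0 * k 0 / d + k 1 * k 1 / d : ℝ) = 1 := by
        rw [← add_div, div_eq_one_iff_eq hd, ← this]; ring
      fin_cases i
      · simp only [P]; norm_num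
        linear_combination (-(k 0 : ℝ)) * hk
      · simp only [P]; norm_num
        linear_combination (-(k 1 : ℝ)) * hk
  have hPc : ∀ s i, (P i 0 * c s k 0 + P i 1 * c s k 1 : ℂ) = c s k i := by
    intro s i
    have := (hc.realDivFree s).div k
    fin_cases i
    · simp only [P]; push_cast; norm_num
      linear_combination (-(k 0 : ℂ) / d) * this
    · simp only [P]; push_cast; norm_num
      linear_combination (-(k 1 : ℂ) / d) * this
  have hgi : ∀ i, IntervalIntegrable (g i) volume 0 T := by
    intro i
    refine IntervalIntegrable.sub ?_ ?_
    · exact ((continuous_const.mul (hc.continuous k i)).neg).intervalIntegrable _ _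
    · exact (((intervalIntegrable_convectionCoeff hc.continuous hM k 0 0 T).const_mul _).add
        ((intervalIntegrable_convectionCoeff hc.continuous hM k 1 0 T).const_mul _)).const_mul _
  have heq : ∀ i, ∀ t ∈ Icc 0 T, c t k i = c 0 k i + ∫ s in (0 : ℝ)..t, g i s := by
    intro i t ht
    have := hc.equation k (P i) (hP i) t ht
    simp only [hPc] at this
    exact this
  have hT : (0 : ℝ) ≤ T := ht.1.trans ht.2
  have hgt : ∀ i, ∀ t ∈ Icc 0 T, IntervalIntegrable (g i) volume 0 t := fun i t ht =>
    (hgi i).mono_set (by rw [uIcc_of_le ht.1, uIcc_of_le hT]; exact Icc_subset_Icc_right ht.2)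
  have hgre : ∀ i, IntervalIntegrable (fun s => (g i s).re) volume 0 T := fun i =>
    ⟨(hgi i).1.re, (hgi i).2.re⟩
  have hgim : ∀ i, IntervalIntegrable (fun s => (g i s).im) volume 0 T := fun i =>
    ⟨(hgi i).1.im, (hgi i).2.im⟩
  have hre : ∀ i, (c t k i).re ^ 2 = (c 0 k i).re ^ 2 +
      ∫ s in (0 : ℝ)..t, 2 * ((c s k i).re * (g i s).re) := by
    intro i
    refine sq_eq_of_eq_integral (a := fun s => (c s k i).re) (hgre i) (fun t ht => ?_) t ht
    rw [heq i t ht, Complex.add_re]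
    congr 1
    exact (Complex.reCLM.intervalIntegral_comp_comm (hgt i t ht)).symm
  have him : ∀ i, (c t k i).im ^ 2 = (c 0 k i).im ^ 2 +
      ∫ s in (0 : ℝ)..t, 2 * ((c s k i).im * (g i s).im) := by
    intro i
    refine sq_eq_of_eq_integral (a := fun s => (c s k i).im) (hgim i) (fun t ht => ?_) t ht
    rw [heq i t ht, Complex.add_im]
    congr 1
    exact (Complex.imCLM.intervalIntegral_comp_comm (hgt i t ht)).symm
  have hire : ∀ i, IntervalIntegrable (fun s => 2 * ((c s k i).re * (g i s).re)) volume 0 t :=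
    fun i => (IntervalIntegrable.continuousOn_mul ⟨(hgt i t ht).1.re, (hgt i t ht).2.re⟩
      (Complex.continuous_re.comp (hc.continuous k i)).continuousOn).const_mul 2
  have hiim : ∀ i, IntervalIntegrable (fun s => 2 * ((c s k i).im * (g i s).im)) volume 0 t :=
    fun i => (IntervalIntegrable.continuousOn_mul ⟨(hgt i t ht).1.im, (hgt i t ht).2.im⟩
      (Complex.continuous_im.comp (hc.continuous k i)).continuousOn).const_mul 2
  have hn : ∀ w : EuclideanSpace ℂ (Fin 2),
      ‖w‖ ^ 2 = (w 0).re ^ 2 + (w 0).im ^ 2 + (w 1).re ^ 2 + (w 1).im ^ 2 := by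
    intro w
    rw [EuclideanSpace.norm_sq_eq, Fin.sum_univ_two, Complex.sq_norm, Complex.sq_norm,
      Complex.normSq_apply, Complex.normSq_apply]
    ring
  have hpt : ∀ s, 2 * (∑' p, triad (c s) (k, p)).im - 2 * (k 0 : ℝ) ^ 2 * ‖c s k‖ ^ 2 =
      2 * ((c s k 0).re * (g 0 s).re) + 2 * ((c s k 0).im * (g 0 s).im) +
        2 * ((c s k 1).re * (g 1 s).re) + 2 * ((c s k 1).im * (g 1 s).im) := by
    intro s
    have h0 := congrArg (starRingEnd ℂ) (hPc s 0)
    have h1 := congrArg (starRingEnd ℂ) (hPc s 1)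
    have hsymm : P 1 0 = P 0 1 := by simp [P, mul_comm]
    simp only [map_add, map_mul, Complex.conj_ofReal] at h0 h1
    -- P is symmetric and fixes c_k, so pairing with c_k removes the projection from the convection
    -- term.
    have hz : (starRingEnd ℂ) (c s k 0) * g 0 s + (starRingEnd ℂ) (c s k 1) * g 1 s =
        -((k 0 : ℂ) ^ 2 * (c s k 0 * (starRingEnd ℂ) (c s k 0) +
          c s k 1 * (starRingEnd ℂ) (c s k 1))) - Complex.I * ∑' p, triad (c s) (k, p) := by
      rw [tsum_triad_eq (hc.energy_one_ne_top s)]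
      rw [hsymm] at h1
      simp only [g, hsymm]
      linear_combination (-Complex.I * convectionCoeff (c s) k 0) * h0 +
        (-Complex.I * convectionCoeff (c s) k 1) * h1
    have hz' := congrArg Complex.re hz
    rw [Complex.mul_conj, Complex.mul_conj] at hz'
    have hk : ((k 0 : ℂ)) ^ 2 = (((k 0 : ℝ) ^ 2 : ℝ) : ℂ) := by push_cast; rfl
    rw [hk, ← Complex.ofReal_add] at hz'
    simp only [Complex.add_re, Complex.sub_re, Complex.neg_re, Complex.ofReal_re,
      Complex.ofReal_im, Complex.I_re, Complex.I_im, Complex.mul_re, Complex.conj_re, Complex.conj_im,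
      Complex.normSq_apply] at hz'
    rw [hn]
    linear_combination (-2) * hz'
  simp only [hpt]
  rw [intervalIntegral.integral_add (((hire 0).add (hiim 0)).add (hire 1)) (hiim 1),
    intervalIntegral.integral_add ((hire 0).add (hiim 0)) (hire 1),
    intervalIntegral.integral_add (hire 0) (hiim 0), hn, hn, hre, hre, him, him]
  ring

end IsFourierSolution
-- Energy inequality for vertical weights
theorem weightedEnergy_horiz_sq_mul (w : ℕ → ℝ≥0) (v : FourierField) :
    weightedEnergy (fun k => horiz k ^ 2 * verticalWeight w k) v =
      ∑' k, verticalWeight w k * (horiz k ^ 2 * ‖v k‖ₑ ^ 2) :=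
  tsum_congr fun k => by ring

theorem enorm_ofReal (r : ℝ) : ‖(r : ℂ)‖ₑ = ‖r‖ₑ := by
  rw [← ofReal_norm, Complex.norm_real, ofReal_norm]

theorem enorm_coe_nnreal_le {a b : ℝ≥0} (h : a ≤ b) : ‖((a : ℝ) : ℂ)‖ₑ ≤ b := by
  rw [← ofReal_norm, Complex.norm_real, NNReal.norm_eq, ENNReal.ofReal_coe_nnreal]
  exact_mod_cast h

namespace IsFourierSolution

variable {T : ℝ} {c : ℝ → FourierField}

theorem continuous_mode (hc : IsFourierSolution T c) (k : Fin 2 → ℤ) :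
    Continuous fun s => c s k :=
  (PiLp.continuous_toLp 2 (fun _ : Fin 2 => ℂ)).comp (continuous_pi fun i => hc.continuous k i)

theorem measurable_enorm (hc : IsFourierSolution T c) (k : Fin 2 → ℤ) :
    Measurable fun s => ‖c s k‖ₑ := (hc.continuous_mode k).enorm.measurable

theorem measurable_weightedEnergy (hc : IsFourierSolution T c) (ω : (Fin 2 → ℤ) → ℝ≥0∞) :
    Measurable fun s => weightedEnergy ω (c s) :=
  Measurable.tsum fun k => ((hc.measurable_enorm k).pow_const 2).const_mul _

theorem measurable_triad (hc : IsFourierSolution T c) (x : (Fin 2 → ℤ) × (Fin 2 → ℤ)) :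
    Measurable fun s => triad (c s) x := by
  simp only [triad, inner_eq]
  have h := hc.continuous
  exact ((((h _ _).mul continuous_const).add ((h _ _).mul continuous_const)).mul
    (((h _ _).mul (Complex.continuous_conj.comp (h _ _))).add
      ((h _ _).mul (Complex.continuous_conj.comp (h _ _))))).measurable

theorem intervalIntegrable_tsum_triad (hc : IsFourierSolution T c) (k : Fin 2 → ℤ) (a b : ℝ) :
    IntervalIntegrable (fun s => ∑' p, triad (c s) (k, p)) volume a b := by
  have : (fun s => ∑' p, triad (c s) (k, p)) = fun s =>
      convectionCoeff (c s) k 0 * (starRingEnd ℂ) (c s k 0) +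
      convectionCoeff (c s) k 1 * (starRingEnd ℂ) (c s k 1) :=
    funext fun s => tsum_triad_eq (hc.energy_one_ne_top s) k
  rw [this]
  obtain ⟨M, hM⟩ := hc.bounded
  have h := fun j => (intervalIntegrable_convectionCoeff hc.continuous hM k j a b).mul_continuousOn
    (Complex.continuous_conj.comp (hc.continuous k j)).continuousOn
  exact (h 0).add (h 1)

/-- The energy balance of finitely many modes, as an inequality in `[0, ∞]`. -/
theorem sum_energy_le (hc : IsFourierSolution T c) (w : ℕ → ℝ≥0) (F : Finset (Fin 2 → ℤ)) {t : ℝ}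
    (ht : t ∈ Icc 0 T) :
    ∑ k ∈ F, verticalWeight w k * ‖c t k‖ₑ ^ 2 + 2 * ∑ k ∈ F, verticalWeight w k *
        ∫⁻ s in Ioc 0 t, horiz k ^ 2 * ‖c s k‖ₑ ^ 2 ≤
      weightedEnergy (verticalWeight w) (c 0) +
        ∫⁻ s in Ioc 0 t, ‖2 * ∑ k ∈ F, (w (k 1).natAbs : ℂ) * ∑' p, triad (c s) (k, p)‖ₑ := by
  have hcont : ∀ k, Continuous fun s => ‖c s k‖ ^ 2 := fun k =>
    (hc.continuous_mode k).norm.pow 2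
  have hσ : ∀ k, IntervalIntegrable (fun s => (∑' p, triad (c s) (k, p)).im) volume 0 t := fun k =>
    ⟨(hc.intervalIntegrable_tsum_triad k 0 t).1.im, (hc.intervalIntegrable_tsum_triad k 0 t).2.im⟩
  have hmode : ∀ k, ‖c t k‖ ^ 2 + 2 * ∫ s in (0 : ℝ)..t, (k 0 : ℝ) ^ 2 * ‖c s k‖ ^ 2 =
      ‖c 0 k‖ ^ 2 + ∫ s in (0 : ℝ)..t, 2 * (∑' p, triad (c s) (k, p)).im := by
    intro k
    have := hc.norm_sq_eq k t ht
    have hD : IntervalIntegrable (fun s => 2 * (k 0 : ℝ) ^ 2 * ‖c s k‖ ^ 2) volume 0 t :=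
      (continuous_const.mul (hcont k)).intervalIntegrable _ _
    rw [intervalIntegral.integral_sub ((hσ k).const_mul 2) hD] at this
    rw [this, ← intervalIntegral.integral_const_mul]
    simp only [mul_assoc]
    ring
  have hsum : ∑ k ∈ F, (w (k 1).natAbs : ℝ) * ‖c t k‖ ^ 2 + 2 * ∑ k ∈ F, (w (k 1).natAbs : ℝ) *
        ∫ s in (0 : ℝ)..t, (k 0 : ℝ) ^ 2 * ‖c s k‖ ^ 2 =
      ∑ k ∈ F, (w (k 1).natAbs : ℝ) * ‖c 0 k‖ ^ 2 +
        ∫ s in (0 : ℝ)..t, (2 * ∑ k ∈ F, (w (k 1).natAbs : ℂ) * ∑' p, triad (c s) (k, p)).im := by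
    have h1 : ∫ s in (0 : ℝ)..t,
        (2 * ∑ k ∈ F, (w (k 1).natAbs : ℂ) * ∑' p, triad (c s) (k, p)).im =
        ∑ k ∈ F, (w (k 1).natAbs : ℝ) * ∫ s in (0 : ℝ)..t, 2 * (∑' p, triad (c s) (k, p)).im := by
      simp only [← intervalIntegral.integral_const_mul]
      rw [← intervalIntegral.integral_finsetSum]
      · refine intervalIntegral.integral_congr fun s _ => ?_
        simp only [Finset.mul_sum, Complex.im_sum]
        refine Finset.sum_congr rfl fun k _ => ?_
        rw [show (2 : ℂ) * ((w (k 1).natAbs : ℂ) * ∑' p, triad (c s) (k, p)) =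
          ((w (k 1).natAbs * 2 : ℝ) : ℂ) * ∑' p, triad (c s) (k, p) by push_cast; ring,
          Complex.im_ofReal_mul]
        ring
      · exact fun k _ => ((hσ k).const_mul 2).const_mul _
    rw [h1, Finset.mul_sum, ← Finset.sum_add_distrib, ← Finset.sum_add_distrib]
    refine Finset.sum_congr rfl fun k _ => ?_
    linear_combination (w (k 1).natAbs : ℝ) * hmode k
  have hterm : ∀ s k, verticalWeight w k * ‖c s k‖ₑ ^ 2 =
      ENNReal.ofReal ((w (k 1).natAbs : ℝ) * ‖c s k‖ ^ 2) := by
    intro s k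
    rw [ENNReal.ofReal_mul (by positivity), ENNReal.ofReal_pow (norm_nonneg _), ofReal_norm,
      ENNReal.ofReal_coe_nnreal, verticalWeight]
  have hterm2 : ∀ k, verticalWeight w k * ∫⁻ s in Ioc 0 t, horiz k ^ 2 * ‖c s k‖ₑ ^ 2 =
      ENNReal.ofReal ((w (k 1).natAbs : ℝ) * ∫ s in (0 : ℝ)..t, (k 0 : ℝ) ^ 2 * ‖c s k‖ ^ 2) := by
    intro k
    rw [ENNReal.ofReal_mul (by positivity), ENNReal.ofReal_coe_nnreal, verticalWeight,
      intervalIntegral.integral_of_le ht.1, ofReal_integral_eq_lintegral_ofReal]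
    · congr 2 with s
      rw [ENNReal.ofReal_mul (by positivity), ENNReal.ofReal_pow (norm_nonneg _), ofReal_norm,
        ← sq_abs, ENNReal.ofReal_pow (abs_nonneg _), horiz, ← Int.cast_abs, ← Nat.cast_natAbs,
        ENNReal.ofReal_natCast]
    · exact ((continuous_const.mul (hcont k)).intervalIntegrable 0 t).1
    · exact Eventually.of_forall fun s => by positivity
  have hnn : ∀ k, 0 ≤ (w (k 1).natAbs : ℝ) *
      ∫ s in (0 : ℝ)..t, (k 0 : ℝ) ^ 2 * ‖c s k‖ ^ 2 := fun k =>
    mul_nonneg (w _).2 (intervalIntegral.integral_nonneg ht.1 fun s _ => by positivity)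
  have htwo : ∀ r : ℝ, (2 : ℝ≥0∞) * ENNReal.ofReal r = ENNReal.ofReal (2 * r) := fun r => by
    rw [ENNReal.ofReal_mul (by norm_num)]; simp
  simp only [hterm, hterm2]
  rw [← ENNReal.ofReal_sum_of_nonneg (fun _ _ => by positivity),
    ← ENNReal.ofReal_sum_of_nonneg (fun k _ => hnn k),
    htwo,
    ← ENNReal.ofReal_add (Finset.sum_nonneg fun _ _ => by positivity) (mul_nonneg (by norm_num)
      (Finset.sum_nonneg fun k _ => hnn k)), hsum]
  refine ENNReal.ofReal_add_le.trans (add_le_add ?_ ?_)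
  · rw [ENNReal.ofReal_sum_of_nonneg (fun _ _ => by positivity)]
    simp only [← hterm]
    exact ENNReal.sum_le_tsum F
  · rw [intervalIntegral.integral_of_le ht.1]
    refine (Real.ofReal_le_enorm _).trans ((enorm_integral_le_lintegral_enorm _).trans ?_)
    refine lintegral_mono fun s => ?_
    rw [← ofReal_norm, ← ofReal_norm]
    exact ENNReal.ofReal_le_ofReal (Complex.abs_im_le_norm _)

theorem tsum_enorm_triad_le (hc : IsFourierSolution T c) :
    ∃ M : ℝ≥0, ∀ s, ∑' x, ‖triad (c s) x‖ₑ ≤ M * energyOneOne (c s) := by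
  obtain ⟨M, hM⟩ := hc.bounded
  refine ⟨8 * (1 + M), fun s => ?_⟩
  rw [← ENNReal.pow_le_pow_left_iff (two_ne_zero)]
  refine (hc.realDivFree s).tsum_enorm_triad_sq_le.trans ?_
  have h1 : weightedEnergy (fun _ => 1) (c s) ≤ (1 + M) ^ 2 :=
    calc weightedEnergy (fun _ => 1) (c s) ≤ M :=
          (weightedEnergy_mono (fun k => one_le_pow₀ le_self_add) _).trans (hM s)
      _ ≤ 1 + 2 * M + M ^ 2 := by
          refine le_trans ?_ le_self_add
          refine le_trans ?_ le_add_self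
          rw [two_mul]; exact le_self_add
      _ = (1 + M) ^ 2 := by ring
  calc _ ≤ 64 * energyOneOne (c s) * energyOneOne (c s) * (1 + M) ^ 2 := by gcongr
    _ = _ := by push_cast; ring

theorem ae_energyOneOne_ne_top (hc : IsFourierSolution T c) {t : ℝ} (ht : t ∈ Icc 0 T) :
    ∀ᵐ s ∂volume.restrict (Ioc 0 t), energyOneOne (c s) ≠ ⊤ := by
  have h : ∫⁻ s in Ioc 0 t, energyOneOne (c s) ≠ ⊤ :=
    ne_top_of_le_ne_top hc.integrable (lintegral_mono_set (Ioc_subset_Ioc_right ht.2))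
  filter_upwards [ae_lt_top (hc.measurable_weightedEnergy _) h] with s hs using hs.ne

theorem measurable_flux (hc : IsFourierSolution T c) (w : ℕ → ℝ≥0) :
    Measurable fun s => flux w (c s) :=
  Measurable.tsum fun x => (hc.measurable_triad x).const_mul _

end IsFourierSolution

/-- Symmetrization of the energy flux for bounded weights. -/
theorem IsRealDivFree.two_mul_tsum_eq_flux {v : FourierField} (hv : IsRealDivFree v)
    {w : ℕ → ℝ≥0} {B : ℝ≥0} (hw : ∀ n, w n ≤ B) (h : ∑' x, ‖triad v x‖ₑ ≠ ⊤) :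
    HasSum (fun k : Fin 2 → ℤ => (w (k 1).natAbs : ℂ) * ∑' p, triad v (k, p))
      (flux w v / 2) := by
  have hbound : ∀ f : (Fin 2 → ℤ) × (Fin 2 → ℤ) → ℂ,
      (∀ x, ‖f x‖ₑ ≤ B * ‖triad v x‖ₑ) → Summable f := by
    intro f hf
    refine Summable.of_enorm (ne_top_of_le_ne_top ?_ (ENNReal.tsum_le_tsum hf))
    rw [ENNReal.tsum_mul_left]
    exact ENNReal.mul_ne_top ENNReal.coe_ne_top h
  have h1 : Summable fun x : (Fin 2 → ℤ) × (Fin 2 → ℤ) => (w (x.1 1).natAbs : ℂ) * triad v x :=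
    hbound _ fun x => by rw [enorm_mul]; gcongr; exact enorm_coe_nnreal_le (hw _)
  have h2 : Summable fun x : (Fin 2 → ℤ) × (Fin 2 → ℤ) =>
      (w ((x.1 - x.2) 1).natAbs : ℂ) * triad v x :=
    hbound _ fun x => by rw [enorm_mul]; gcongr; exact enorm_coe_nnreal_le (hw _)
  have h3 : ∑' x : (Fin 2 → ℤ) × (Fin 2 → ℤ), (w ((x.1 - x.2) 1).natAbs : ℂ) * triad v x =
      -∑' x : (Fin 2 → ℤ) × (Fin 2 → ℤ), (w (x.1 1).natAbs : ℂ) * triad v x := by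
    rw [← reflectPair.tsum_eq fun x : (Fin 2 → ℤ) × (Fin 2 → ℤ) =>
      (w (x.1 1).natAbs : ℂ) * triad v x, ← tsum_neg]
    refine tsum_congr fun x => ?_
    rw [hv.triad_reflectPair, reflectPair_apply]
    have : ((x.2 - x.1) 1).natAbs = ((x.1 - x.2) 1).natAbs := by
      simp only [Pi.sub_apply]; omega
    simp only [this]
    ring
  have h4 : flux w v = 2 * ∑' x : (Fin 2 → ℤ) × (Fin 2 → ℤ), (w (x.1 1).natAbs : ℂ) * triad v x := by
    simp only [flux, weightDiff]
    push_cast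
    simp only [sub_mul]
    rw [h1.tsum_sub h2, h3]
    ring
  rw [h4, mul_div_cancel_left₀ _ (two_ne_zero)]
  have h5 := h1.hasSum.prod_fiberwise fun k => (h1.prod_factor k).hasSum
  simpa only [tsum_mul_left] using h5

namespace IsFourierSolution

variable {T : ℝ} {c : ℝ → FourierField}

/-- The flux of all modes is the limit of the partial sums on the right of `sum_energy_le`,
dominated in time by a multiple of the H^{1,1} norm squared. On the left the finite set can be kept,
since partial sums increase. -/
theorem sum_energy_le_flux_of_bounded (hc : IsFourierSolution T c) {w : ℕ → ℝ≥0} {B : ℝ≥0}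
    (hw : ∀ n, w n ≤ B) (F : Finset (Fin 2 → ℤ)) {t : ℝ} (ht : t ∈ Icc 0 T) :
    ∑ k ∈ F, verticalWeight w k * ‖c t k‖ₑ ^ 2 + 2 * ∑ k ∈ F, verticalWeight w k *
        ∫⁻ s in Ioc 0 t, horiz k ^ 2 * ‖c s k‖ₑ ^ 2 ≤
      weightedEnergy (verticalWeight w) (c 0) + ∫⁻ s in Ioc 0 t, ‖flux w (c s)‖ₑ := by
  obtain ⟨M, hM⟩ := hc.tsum_enorm_triad_le
  have hlim : Tendsto (fun F : Finset (Fin 2 → ℤ) =>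
      ∫⁻ s in Ioc 0 t, ‖2 * ∑ k ∈ F, (w (k 1).natAbs : ℂ) * ∑' p, triad (c s) (k, p)‖ₑ) atTop
      (𝓝 (∫⁻ s in Ioc 0 t, ‖flux w (c s)‖ₑ)) := by
    refine tendsto_lintegral_filter_of_dominated_convergence
      (fun s => 2 * (B * (M * energyOneOne (c s)))) ?_ ?_ ?_ ?_
    · refine Eventually.of_forall fun F => Measurable.enorm (Measurable.const_mul ?_ _)
      refine Finset.measurable_sum _ fun k _ => Measurable.const_mul ?_ _
      exact Measurable.tsum fun p => hc.measurable_triad _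
    · refine Eventually.of_forall fun F => Eventually.of_forall fun s => ?_
      rw [enorm_mul, show ‖(2 : ℂ)‖ₑ = 2 by simp [← ofReal_norm]]
      gcongr
      refine (enorm_sum_le _ _).trans ((ENNReal.sum_le_tsum F).trans ?_)
      refine le_trans (ENNReal.tsum_le_tsum (g := fun k => B * ∑' p, ‖triad (c s) (k, p)‖ₑ)
        fun k => ?_) ?_
      · rw [enorm_mul]
        gcongr
        · exact enorm_coe_nnreal_le (hw _)
        · exact enorm_tsum_le_tsum_enorm
      · rw [ENNReal.tsum_mul_left, ← ENNReal.tsum_prod (f := fun k p => ‖triad (c s) (k, p)‖ₑ)]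
        gcongr
        exact hM s
    · rw [lintegral_const_mul' _ _ (by simp), lintegral_const_mul' _ _ (by simp),
        lintegral_const_mul' _ _ (by simp)]
      have h : ∫⁻ s in Ioc 0 t, energyOneOne (c s) ≠ ⊤ :=
        ne_top_of_le_ne_top hc.integrable (lintegral_mono_set (Ioc_subset_Ioc_right ht.2))
      finiteness
    · filter_upwards [hc.ae_energyOneOne_ne_top ht] with s hs
      have hfin : ∑' x, ‖triad (c s) x‖ₑ ≠ ⊤ :=
        ne_top_of_le_ne_top (ENNReal.mul_ne_top ENNReal.coe_ne_top hs) (hM s)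
      have h : Tendsto (fun F : Finset (Fin 2 → ℤ) => ∑ k ∈ F,
          (w (k 1).natAbs : ℂ) * ∑' p, triad (c s) (k, p)) atTop (𝓝 (flux w (c s) / 2)) :=
        (hc.realDivFree s).two_mul_tsum_eq_flux hw hfin
      have h2 := (h.const_mul 2).enorm
      rwa [mul_div_cancel₀ _ (two_ne_zero)] at h2
  refine ge_of_tendsto (hlim.const_add _) ?_
  filter_upwards [eventually_ge_atTop F] with G hG
  refine le_trans ?_ (hc.sum_energy_le w G ht)
  gcongr

/-- The energy inequality with a vertical weight. -/
theorem weightedEnergy_add_le (hc : IsFourierSolution T c) {w : ℕ → ℝ≥0}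
    (hw : ∫⁻ s in Ioc 0 T, absFlux w (c s) ≠ ⊤) {t : ℝ} (ht : t ∈ Icc 0 T) :
    weightedEnergy (verticalWeight w) (c t) + 2 * ∫⁻ s in Ioc 0 t,
        weightedEnergy (fun k => horiz k ^ 2 * verticalWeight w k) (c s) ≤
      weightedEnergy (verticalWeight w) (c 0) + ∫⁻ s in Ioc 0 t, ‖flux w (c s)‖ₑ := by
  have hwt : ∫⁻ s in Ioc 0 t, absFlux w (c s) ≠ ⊤ :=
    ne_top_of_le_ne_top hw (lintegral_mono_set (Ioc_subset_Ioc_right ht.2))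
  have hmeas : Measurable fun s => absFlux w (c s) :=
    Measurable.tsum fun x => (hc.measurable_triad x).enorm.const_mul _
  -- Cutting the weight off at height M does not increase its differences, so `absFlux w` dominates
  -- all the truncated fluxes as M tends to infinity.
  let wM : ℕ → ℕ → ℝ≥0 := fun M n => min (w n) M
  have hdiff : ∀ M x, ‖weightDiff (wM M) x‖ₑ ≤ ‖weightDiff w x‖ₑ := by
    intro M x
    rw [← ofReal_norm, ← ofReal_norm, Real.norm_eq_abs, Real.norm_eq_abs]
    refine ENNReal.ofReal_le_ofReal ?_
    simp only [weightDiff, wM, NNReal.coe_min]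
    refine (abs_min_sub_min_le_max _ _ _ _).trans ?_
    simp
  have hlim : Tendsto (fun M : ℕ => ∫⁻ s in Ioc 0 t, ‖flux (wM M) (c s)‖ₑ) atTop
      (𝓝 (∫⁻ s in Ioc 0 t, ‖flux w (c s)‖ₑ)) := by
    refine tendsto_lintegral_of_dominated_convergence (fun s => absFlux w (c s))
      (fun M => (hc.measurable_flux _).enorm) (fun M => Eventually.of_forall fun s => ?_) hwt ?_
    · refine (enorm_flux_le _ _).trans (ENNReal.tsum_le_tsum fun x => ?_)
      gcongr
      exact hdiff M x
    · filter_upwards [ae_lt_top hmeas hwt] with s hs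
      refine (continuous_enorm.tendsto _).comp ?_
      refine tendsto_tsum_of_dominated_convergence
        (bound := fun x => ‖(weightDiff w x : ℂ) * triad (c s) x‖) ?_ ?_ ?_
      · refine (tsum_enorm_ne_top_iff_summable_norm).1 ?_
        simp only [enorm_mul, enorm_ofReal]
        exact hs.ne
      · intro x
        refine tendsto_const_nhds.congr' ?_
        obtain ⟨M₀, hM₀⟩ := exists_nat_ge (max (w (x.1 1).natAbs) (w ((x.1 - x.2) 1).natAbs))
        filter_upwards [eventually_ge_atTop M₀] with M hM
        have hM' : max (w (x.1 1).natAbs) (w ((x.1 - x.2) 1).natAbs) ≤ M :=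
          hM₀.trans (by exact_mod_cast hM)
        simp only [weightDiff, wM]
        rw [min_eq_left ((le_max_left _ _).trans hM'), min_eq_left ((le_max_right _ _).trans hM')]
      · refine Eventually.of_forall fun M x => ?_
        rw [norm_mul, norm_mul, Complex.norm_real, Complex.norm_real]
        gcongr
        have := hdiff M x
        rwa [← ofReal_norm, ← ofReal_norm, ENNReal.ofReal_le_ofReal_iff (norm_nonneg _)] at this
  have hfin : ∀ F : Finset (Fin 2 → ℤ),
      ∑ k ∈ F, verticalWeight w k * ‖c t k‖ₑ ^ 2 + 2 * ∑ k ∈ F, verticalWeight w k *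
        ∫⁻ s in Ioc 0 t, horiz k ^ 2 * ‖c s k‖ₑ ^ 2 ≤
      weightedEnergy (verticalWeight w) (c 0) + ∫⁻ s in Ioc 0 t, ‖flux w (c s)‖ₑ := by
    intro F
    refine ge_of_tendsto (hlim.const_add _) ?_
    -- Beyond the sum of the weights over `F`, the cutoff changes none of them on `F`.
    obtain ⟨M₀, hM₀⟩ := exists_nat_ge (∑ k ∈ F, w (k 1).natAbs)
    filter_upwards [eventually_ge_atTop M₀] with M hM
    have hwk : ∀ k ∈ F, verticalWeight w k = verticalWeight (wM M) k := by
      intro k hk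
      simp only [verticalWeight, wM]
      rw [min_eq_left]
      exact (Finset.single_le_sum (f := fun k : Fin 2 → ℤ => w (k 1).natAbs)
        (fun _ _ => zero_le) hk).trans (hM₀.trans (by exact_mod_cast hM))
    have h1 := hc.sum_energy_le_flux_of_bounded (w := wM M) (B := M) (fun n => min_le_right _ _) F ht
    rw [Finset.sum_congr rfl fun k hk => by rw [hwk k hk],
      Finset.sum_congr (f := fun k => verticalWeight w k * _) rfl fun k hk => by rw [hwk k hk]]
    refine h1.trans ?_
    gcongr
    refine weightedEnergy_mono (fun k => ?_) _
    simp only [verticalWeight, wM]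
    exact_mod_cast min_le_left _ _
  simp only [weightedEnergy_horiz_sq_mul]
  rw [lintegral_tsum fun k => ((((hc.measurable_enorm k).pow_const 2).const_mul _).const_mul
    _).aemeasurable]
  simp only [verticalWeight] at hfin ⊢
  simp only [lintegral_const_mul' _ _ ENNReal.coe_ne_top]
  have hs : ∀ f : (Fin 2 → ℤ) → ℝ≥0∞,
      Tendsto (fun F : Finset (Fin 2 → ℤ) => ∑ k ∈ F, f k) atTop (𝓝 (∑' k, f k)) :=
    fun f => ENNReal.summable.hasSum
  exact le_of_tendsto' ((hs _).add (ENNReal.Tendsto.const_mul (hs _) (Or.inr (by simp)))) hfin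

end IsFourierSolution
-- A priori bounds
theorem truncSymbol_le (N : ℕ) (k : Fin 2 → ℤ) : truncSymbol N k ≤ N * vert k := by
  simp only [truncSymbol, vert]
  rw [mul_comm (N : ℝ≥0∞)]
  exact_mod_cast Nat.mul_le_mul_left _ (min_le_right _ _)

theorem verticalWeight_truncWeight_le_mul (N : ℕ) (k : Fin 2 → ℤ) :
    verticalWeight (truncWeight N) k ≤ N ^ 2 * vert k ^ 2 := by
  rw [verticalWeight_truncWeight, ← mul_pow]
  exact pow_le_pow_left' (truncSymbol_le N k) 2

theorem verticalWeight_truncWeight_le_pow (N : ℕ) (k : Fin 2 → ℤ) :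
    verticalWeight (truncWeight N) k ≤ vert k ^ 4 := by
  rw [verticalWeight_truncWeight, show vert k ^ 4 = (vert k * vert k) ^ 2 by ring]
  refine pow_le_pow_left' ?_ 2
  simp only [truncSymbol, vert]
  exact_mod_cast Nat.mul_le_mul_left _ (min_le_left _ _)

/-- Removal of the truncation of the weight. -/
theorem tsum_vert_pow_four_mul_le {f : (Fin 2 → ℤ) → ℝ≥0∞} {C : ℝ≥0∞}
    (h : ∀ N, ∑' k, verticalWeight (truncWeight N) k * f k ≤ C) : ∑' k, vert k ^ 4 * f k ≤ C := by
  rw [ENNReal.tsum_eq_iSup_sum]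
  refine iSup_le fun F => ?_
  -- With N at least every |k₂| on the finite set, the truncation is inactive there.
  refine le_trans ?_ (h (∑ k ∈ F, (k 1).natAbs))
  refine le_trans (le_of_eq ?_) (ENNReal.sum_le_tsum F)
  refine Finset.sum_congr rfl fun k hk => ?_
  rw [verticalWeight_truncWeight, truncSymbol, min_eq_left
    (Finset.single_le_sum (f := fun k : Fin 2 → ℤ => (k 1).natAbs) (fun _ _ => zero_le) hk), vert]
  push_cast
  ring

namespace IsFourierSolution

variable {T : ℝ} {c : ℝ → FourierField}

/-- An energy flux that is controlled by the dissipation and, with an integrable coefficient, by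
the energy yields a bound of the energy and of the dissipation. -/
theorem energy_bound (hc : IsFourierSolution T c) (hT : 0 ≤ T) {w : ℕ → ℝ≥0} {h : ℝ → ℝ≥0∞}
    (hm : Measurable h) (hw : ∫⁻ s in Ioc 0 T, absFlux w (c s) ≠ ⊤)
    (hflux : ∀ᵐ s ∂volume.restrict (Ioc 0 T), ‖flux w (c s)‖ₑ ≤
      weightedEnergy (fun k => horiz k ^ 2 * verticalWeight w k) (c s) +
        h s * (1 + weightedEnergy (verticalWeight w) (c s)))
    (hD : ∫⁻ s in Ioc 0 T, weightedEnergy (fun k => horiz k ^ 2 * verticalWeight w k) (c s) ≠ ⊤)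
    {B : ℝ≥0} (hB : ∀ s, weightedEnergy (verticalWeight w) (c s) ≤ B)
    {H : ℝ≥0} (hH : ∫⁻ s in Ioc 0 T, h s ≤ H) {n : ℕ} (hn : 2 * H ≤ n) {E₀ : ℝ≥0}
    (hE₀ : weightedEnergy (verticalWeight w) (c 0) ≤ E₀) :
    (∀ t ∈ Icc 0 T, weightedEnergy (verticalWeight w) (c t) ≤ 2 ^ n * (1 + E₀)) ∧
      ∫⁻ s in Ioc 0 T, weightedEnergy (fun k => horiz k ^ 2 * verticalWeight w k) (c s) ≤
        E₀ + H * (2 ^ n * (1 + E₀)) := by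
  have hEm := hc.measurable_weightedEnergy (verticalWeight w)
  have hDm := hc.measurable_weightedEnergy (fun k => horiz k ^ 2 * verticalWeight w k)
  set E : ℝ → ℝ≥0∞ := fun s => weightedEnergy (verticalWeight w) (c s) with hE
  set D : ℝ → ℝ≥0∞ := fun s => weightedEnergy (fun k => horiz k ^ 2 * verticalWeight w k) (c s)
    with hDdef
  have key : ∀ t ∈ Icc 0 T, E t + ∫⁻ s in Ioc 0 t, D s ≤
      E₀ + ∫⁻ s in Ioc 0 t, h s * (1 + E s) := by
    intro t ht
    have h1 := hc.weightedEnergy_add_le hw ht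
    have hDt : ∫⁻ s in Ioc 0 t, D s ≠ ⊤ :=
      ne_top_of_le_ne_top hD (lintegral_mono_set (Ioc_subset_Ioc_right ht.2))
    have h2 : ∫⁻ s in Ioc 0 t, ‖flux w (c s)‖ₑ ≤
        (∫⁻ s in Ioc 0 t, D s) + ∫⁻ s in Ioc 0 t, h s * (1 + E s) := by
      rw [← lintegral_add_left hDm]
      refine lintegral_mono_ae ?_
      exact ae_restrict_of_ae_restrict_of_subset (Ioc_subset_Ioc_right ht.2) hflux
    -- The flux uses up one of the two copies of the dissipation; cancelling it requires its
    -- finiteness, hypothesis `hD`.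
    refine ENNReal.le_of_add_le_add_right hDt ?_
    calc E t + (∫⁻ s in Ioc 0 t, D s) + ∫⁻ s in Ioc 0 t, D s
        = E t + 2 * ∫⁻ s in Ioc 0 t, D s := by rw [two_mul, add_assoc]
      _ ≤ E 0 + ∫⁻ s in Ioc 0 t, ‖flux w (c s)‖ₑ := h1
      _ ≤ E₀ + ((∫⁻ s in Ioc 0 t, D s) + ∫⁻ s in Ioc 0 t, h s * (1 + E s)) :=
          add_le_add hE₀ h2
      _ = _ := by rw [add_comm (∫⁻ s in Ioc 0 t, D s), add_assoc]
  -- The bound `B` enters only here, to make Grönwall's integral finite; it does not reach the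
  -- conclusion.
  have hfin : ∫⁻ s in Ioc 0 T, h s * (1 + E s) ≠ ⊤ := by
    refine ne_top_of_le_ne_top (b := (H : ℝ≥0∞) * (1 + B)) (by finiteness) ?_
    calc ∫⁻ s in Ioc 0 T, h s * (1 + E s) ≤ ∫⁻ s in Ioc 0 T, h s * (1 + B) := by
          refine lintegral_mono fun s => ?_
          gcongr
          exact hB s
      _ = (∫⁻ s in Ioc 0 T, h s) * (1 + B) := lintegral_mul_const _ hm
      _ ≤ _ := by gcongr
  have hy := le_two_pow_mul_of_le_add_lintegral (y := fun s => 1 + E s) (A := 1 + E₀) hm hH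
    ENNReal.coe_ne_top hfin (fun t ht => by
      rw [add_assoc]
      exact add_le_add le_rfl (le_self_add.trans (key t ht))) (n := n) (by exact_mod_cast hn)
  refine ⟨fun t ht => le_add_self.trans (hy t ht), ?_⟩
  refine le_add_self.trans ((key T ⟨hT, le_rfl⟩).trans ?_)
  gcongr
  calc ∫⁻ s in Ioc 0 T, h s * (1 + E s) ≤ ∫⁻ s in Ioc 0 T, h s * (2 ^ n * (1 + E₀)) := by
        refine setLIntegral_mono' measurableSet_Ioc fun s hs => ?_
        gcongr
        exact hy s ⟨hs.1.le, hs.2⟩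
    _ = (∫⁻ s in Ioc 0 T, h s) * (2 ^ n * (1 + E₀)) := lintegral_mul_const _ hm
    _ ≤ _ := by gcongr

/-- The basic energy inequality. -/
theorem energy_le (hc : IsFourierSolution T c) {t : ℝ} (ht : t ∈ Icc 0 T) :
    weightedEnergy (fun _ => 1) (c t) + 2 * ∫⁻ s in Ioc 0 t,
      weightedEnergy (fun k => horiz k ^ 2) (c s) ≤ weightedEnergy (fun _ => 1) (c 0) := by
  -- A constant weight has zero differences, so its flux vanishes.
  have h := hc.weightedEnergy_add_le (w := fun _ => 1) (by simp [absFlux, weightDiff_const]) ht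
  have hone : verticalWeight (fun _ => 1) = fun _ => 1 := funext fun k => by simp [verticalWeight]
  simpa [flux, weightDiff_const, hone] using h

theorem lintegral_absFlux_sqWeight_ne_top (hc : IsFourierSolution T c) :
    ∫⁻ s in Ioc 0 T, absFlux sqWeight (c s) ≠ ⊤ := by
  obtain ⟨M, hM⟩ := hc.bounded
  refine ne_top_of_le_ne_top (b := (32 * (1 + M)) * ∫⁻ s in Ioc 0 T, energyOneOne (c s)) ?_ ?_
  · have := hc.integrable
    finiteness
  rw [← lintegral_const_mul' _ _ (by finiteness)]
  refine lintegral_mono fun s => ?_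
  rw [← ENNReal.pow_le_pow_left_iff (two_ne_zero)]
  refine (hc.realDivFree s).absFlux_sqWeight_sq_le.trans ?_
  have h1 : weightedEnergy (verticalWeight sqWeight) (c s) ≤ (1 + M) ^ 2 :=
    calc weightedEnergy (verticalWeight sqWeight) (c s) ≤ M :=
          (weightedEnergy_mono (fun k => by
            rw [verticalWeight_sqWeight]; gcongr; exact le_add_self) _).trans (hM s)
      _ ≤ 1 + 2 * M + M ^ 2 := by
          refine le_trans ?_ le_self_add
          refine le_trans ?_ le_add_self
          rw [two_mul]; exact le_self_add
      _ = (1 + M) ^ 2 := by ring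
  calc _ ≤ 1024 * energyOneOne (c s) * energyOneOne (c s) * (1 + (M : ℝ≥0∞)) ^ 2 := by gcongr
    _ = _ := by ring

end IsFourierSolution

/-- The a priori bound of the first order energies. -/
theorem exists_lintegral_energyOneOne_le {T : ℝ} (hT : 0 ≤ T) (R : ℝ≥0) :
    ∃ Q : ℝ≥0, ∀ c : ℝ → FourierField, IsFourierSolution T c →
      weightedEnergy (fun _ => 1) (c 0) ≤ R → weightedEnergy (fun k => vert k ^ 2) (c 0) ≤ R →
      ∫⁻ s in Ioc 0 T, energyOneOne (c s) ≤ Q := by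
  -- The Grönwall coefficient is 2048‖∂₁u‖², whose time integral is at most 2048R by the basic
  -- energy inequality.
  obtain ⟨n, hn⟩ := exists_nat_ge (2 * (2048 * R))
  refine ⟨4 * (R * T.toNNReal + R + (2 ^ n * (1 + R)) * T.toNNReal +
    (R + 2048 * R * (2 ^ n * (1 + R)))), fun c hc h0 h1 => ?_⟩
  have hv : (fun k => vert k ^ 2) = verticalWeight sqWeight :=
    funext fun k => (verticalWeight_sqWeight k).symm
  have hE : ∀ t ∈ Icc 0 T, weightedEnergy (fun _ => 1) (c t) ≤ R := fun t ht =>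
    le_self_add.trans ((hc.energy_le ht).trans h0)
  have ha : ∫⁻ s in Ioc 0 T, weightedEnergy (fun k => horiz k ^ 2) (c s) ≤ R := by
    refine le_trans ?_ ((hc.energy_le ⟨hT, le_rfl⟩).trans h0)
    refine le_trans ?_ le_add_self
    rw [two_mul]
    exact le_self_add
  obtain ⟨M, hM⟩ := hc.bounded
  have hb := hc.energy_bound hT (w := sqWeight)
    (h := fun s => 2048 * weightedEnergy (fun k => horiz k ^ 2) (c s)) (B := M) (H := 2048 * R)
    (E₀ := R) (n := n) ((hc.measurable_weightedEnergy _).const_mul _)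
    hc.lintegral_absFlux_sqWeight_ne_top (by
      filter_upwards [hc.ae_energyOneOne_ne_top ⟨hT, le_rfl⟩] with s hs
      refine (hc.realDivFree s).enorm_flux_sqWeight_le hs ?_
      rw [← hv]
      exact ne_top_of_le_ne_top ENNReal.coe_ne_top ((weightedEnergy_mono (fun k => by
            gcongr; exact le_add_self) _).trans (hM s)))
    (by
      refine ne_top_of_le_ne_top hc.integrable (lintegral_mono fun s => ?_)
      refine weightedEnergy_mono (fun k => ?_) _
      rw [verticalWeight_sqWeight, ← mul_pow]
      gcongr <;> exact le_add_self)
    (fun s => by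
      rw [← hv]
      exact (weightedEnergy_mono (fun k => by gcongr; exact le_add_self) _).trans (hM s))
    (by
      rw [lintegral_const_mul' _ _ (by simp)]
      push_cast
      gcongr)
    (by exact_mod_cast hn) (by rwa [← hv])
  rw [← hv] at hb
  have hvol : volume (Ioc 0 T) = T.toNNReal := by
    rw [Real.volume_Ioc, sub_zero]; rfl
  -- The H^{1,1} norm squared is at most four times the sum of ‖u‖², ‖∂₁u‖², ‖∂₂u‖² and ‖∂₁∂₂u‖²,
  -- all of which are now controlled.
  have hY : ∀ s, energyOneOne (c s) ≤ 4 * (weightedEnergy (fun _ => 1) (c s) +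
      weightedEnergy (fun k => horiz k ^ 2) (c s) + weightedEnergy (fun k => vert k ^ 2) (c s) +
        weightedEnergy (fun k => horiz k ^ 2 * verticalWeight sqWeight k) (c s)) := by
    intro s
    rw [← weightedEnergy_add, ← weightedEnergy_add, ← weightedEnergy_add,
      ← weightedEnergy_const_mul]
    refine weightedEnergy_mono (fun k => ?_) _
    calc ((1 + horiz k) * (1 + vert k)) ^ 2
        ≤ (2 * (1 ^ 2 + horiz k ^ 2)) * (2 * (1 ^ 2 + vert k ^ 2)) := by
          rw [mul_pow]
          exact mul_le_mul' (add_sq_le_two_mul _ _) (add_sq_le_two_mul _ _)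
      _ = _ := by rw [verticalWeight_sqWeight]; ring
  refine (lintegral_mono hY).trans ?_
  rw [lintegral_const_mul' _ _ (by simp), lintegral_add_right _ (hc.measurable_weightedEnergy _),
    lintegral_add_right _ (hc.measurable_weightedEnergy _),
    lintegral_add_right _ (hc.measurable_weightedEnergy _)]
  push_cast
  gcongr
  · refine (setLIntegral_mono' measurableSet_Ioc fun s hs => hE s ⟨hs.1.le, hs.2⟩).trans ?_
    rw [setLIntegral_const, hvol]
  · refine (setLIntegral_mono' measurableSet_Ioc fun s hs => hb.1 s ⟨hs.1.le, hs.2⟩).trans ?_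
    rw [setLIntegral_const, hvol]
  · exact_mod_cast hb.2

/-- The a priori bound of the second order vertical energies. -/
theorem exists_second_order_bound {T : ℝ} (hT : 0 ≤ T) (R : ℝ≥0) :
    ∃ C : ℝ≥0, ∀ c : ℝ → FourierField, IsFourierSolution T c →
      weightedEnergy (fun k => (1 + vert k ^ 2) ^ 2) (c 0) ≤ R →
      (∀ t ∈ Icc 0 T, weightedEnergy (fun k => (1 + vert k ^ 2) ^ 2) (c t) ≤ C) ∧
      ∫⁻ s in Ioc 0 T, weightedEnergy (fun k => (1 + horiz k ^ 2) * (1 + vert k ^ 2) ^ 2) (c s) ≤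
        C := by
  obtain ⟨Q, hQ⟩ := exists_lintegral_energyOneOne_le hT R
  obtain ⟨n, hn⟩ := exists_nat_ge (2 * (T.toNNReal + 57344 * Q))
  set K : ℝ≥0 := 2 ^ n * (1 + R) with hK
  set L : ℝ≥0 := R + (T.toNNReal + 57344 * Q) * K with hL
  refine ⟨2 * (R + K) + 2 * (R * T.toNNReal + K * T.toNNReal + Q + L), fun c hc h0 => ?_⟩
  have hvol : volume (Ioc 0 T) = T.toNNReal := by
    rw [Real.volume_Ioc, sub_zero]; rfl
  have h00 : weightedEnergy (fun _ => 1) (c 0) ≤ R :=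
    (weightedEnergy_mono (fun k => one_le_pow₀ le_self_add) _).trans h0
  have h01 : weightedEnergy (fun k => vert k ^ 2) (c 0) ≤ R := by
    refine (weightedEnergy_mono (fun k => ?_) _).trans h0
    exact le_add_self.trans (le_self_pow₀ le_self_add two_ne_zero)
  have hY := hQ c hc h00 h01
  have hE : ∀ t ∈ Icc 0 T, weightedEnergy (fun _ => 1) (c t) ≤ R := fun t ht =>
    le_self_add.trans ((hc.energy_le ht).trans h00)
  obtain ⟨M, hM⟩ := hc.bounded
  -- This bound and the next depend on N and on the solution. They provide only the finiteness
  -- required by `energy_bound`; the resulting estimates are uniform in N.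
  have hBN : ∀ (N : ℕ) (s : ℝ), weightedEnergy (verticalWeight (truncWeight N)) (c s) ≤
      ((N ^ 2 * M : ℝ≥0) : ℝ≥0∞) := by
    intro N s
    push_cast
    refine (weightedEnergy_mono (verticalWeight_truncWeight_le_mul N) _).trans ?_
    rw [weightedEnergy_const_mul]
    gcongr
    exact (weightedEnergy_mono (fun k => by gcongr; exact le_add_self) _).trans (hM s)
  have hDN : ∀ (N : ℕ) (s : ℝ), weightedEnergy
      (fun k => horiz k ^ 2 * verticalWeight (truncWeight N) k) (c s) ≤
      N ^ 2 * energyOneOne (c s) := by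
    intro N s
    rw [energyOneOne, ← weightedEnergy_const_mul]
    refine weightedEnergy_mono (fun k => ?_) _
    calc _ ≤ horiz k ^ 2 * (N ^ 2 * vert k ^ 2) := by
          gcongr; exact verticalWeight_truncWeight_le_mul N k
      _ = N ^ 2 * (horiz k * vert k) ^ 2 := by ring
      _ ≤ _ := by gcongr <;> exact le_add_self
  have hYfin := hc.integrable
  have hhm : Measurable fun s => 1 + 57344 * energyOneOne (c s) :=
    ((hc.measurable_weightedEnergy _).const_mul _).const_add _
  have hhint : ∫⁻ s in Ioc 0 T, (1 + 57344 * energyOneOne (c s)) ≤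
      ((T.toNNReal + 57344 * Q : ℝ≥0) : ℝ≥0∞) := by
    rw [lintegral_add_left measurable_const, lintegral_const_mul' _ _ (by simp),
      setLIntegral_const, hvol]
    push_cast
    rw [one_mul]
    gcongr
  have hN : ∀ N : ℕ, _ := fun N => hc.energy_bound hT (w := truncWeight N)
    (h := fun s => 1 + 57344 * energyOneOne (c s)) (B := N ^ 2 * M)
    (H := T.toNNReal + 57344 * Q) (E₀ := R) (n := n) hhm
    (by
      refine ne_top_of_le_ne_top ?_ (lintegral_mono fun s =>
        ((hc.realDivFree s).absFlux_truncWeight_le N).trans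
          (add_le_add (hDN N s) (mul_le_mul_right (hBN N s) _)))
      rw [lintegral_add_right _ (hhm.mul_const _), lintegral_mul_const _ hhm,
        lintegral_const_mul' _ _ (by finiteness)]
      exact ENNReal.add_ne_top.2 ⟨ENNReal.mul_ne_top (by finiteness) hYfin,
        ENNReal.mul_ne_top (ne_top_of_le_ne_top ENNReal.coe_ne_top hhint) ENNReal.coe_ne_top⟩)
    (Eventually.of_forall fun s => by
      refine (enorm_flux_le _ _).trans (((hc.realDivFree s).absFlux_truncWeight_le N).trans ?_)
      gcongr
      exact le_add_self)
    (by
      refine ne_top_of_le_ne_top ?_ (lintegral_mono fun s => hDN N s)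
      rw [lintegral_const_mul' _ _ (by finiteness)]
      finiteness)
    (hBN N) hhint (by exact_mod_cast hn)
    (by
      refine (weightedEnergy_mono (fun k => (verticalWeight_truncWeight_le_pow N k).trans ?_)
        _).trans h0
      calc vert k ^ 4 = (vert k ^ 2) ^ 2 := by ring
        _ ≤ _ := by gcongr; exact le_add_self)
  have hE4 : ∀ t ∈ Icc 0 T, weightedEnergy (fun k => vert k ^ 4) (c t) ≤ K := by
    intro t ht
    refine tsum_vert_pow_four_mul_le fun N => ?_
    refine ((hN N).1 t ht).trans (le_of_eq ?_)
    rw [hK]; push_cast; rfl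
  have hD4 : ∫⁻ s in Ioc 0 T, weightedEnergy (fun k => horiz k ^ 2 * vert k ^ 4) (c s) ≤ L := by
    have hmk : ∀ k, Measurable fun s => horiz k ^ 2 * ‖c s k‖ₑ ^ 2 := fun k =>
      ((hc.measurable_enorm k).pow_const 2).const_mul _
    have e1 : ∀ s, weightedEnergy (fun k => horiz k ^ 2 * vert k ^ 4) (c s) =
        ∑' k, vert k ^ 4 * (horiz k ^ 2 * ‖c s k‖ₑ ^ 2) := fun s => tsum_congr fun k => by ring
    simp only [e1]
    -- Sum and time integral are exchanged so that the truncation can be removed mode by mode.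
    rw [lintegral_tsum fun k => ((hmk k).const_mul _).aemeasurable]
    simp only [lintegral_const_mul _ (hmk _)]
    refine tsum_vert_pow_four_mul_le fun N => ?_
    simp only [← lintegral_const_mul _ (hmk _)]
    rw [← lintegral_tsum fun k => ((hmk k).const_mul _).aemeasurable]
    simp only [← weightedEnergy_horiz_sq_mul]
    refine (hN N).2.trans (le_of_eq ?_)
    rw [hL, hK]; push_cast; rfl
  have hsq : ∀ k : Fin 2 → ℤ, (1 + vert k ^ 2) ^ 2 ≤ 2 * (1 + vert k ^ 4) := fun k =>
    (add_sq_le_two_mul _ _).trans (le_of_eq (by ring))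
  constructor
  · intro t ht
    refine (weightedEnergy_mono hsq _).trans ?_
    rw [weightedEnergy_const_mul, weightedEnergy_add]
    push_cast
    refine le_trans ?_ le_self_add
    gcongr
    · exact hE t ht
    · exact hE4 t ht
  · have hpt : ∀ s, weightedEnergy (fun k => (1 + horiz k ^ 2) * (1 + vert k ^ 2) ^ 2) (c s) ≤
        2 * (weightedEnergy (fun _ => 1) (c s) + weightedEnergy (fun k => vert k ^ 4) (c s) +
          energyOneOne (c s) + weightedEnergy (fun k => horiz k ^ 2 * vert k ^ 4) (c s)) := by
      intro s
      rw [energyOneOne, ← weightedEnergy_add, ← weightedEnergy_add, ← weightedEnergy_add,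
        ← weightedEnergy_const_mul]
      refine weightedEnergy_mono (fun k => ?_) _
      have h1 : horiz k ^ 2 ≤ ((1 + horiz k) * (1 + vert k)) ^ 2 := by
        gcongr
        calc horiz k ≤ 1 + horiz k := le_add_self
          _ ≤ _ := le_mul_of_one_le_right' le_self_add
      calc _ ≤ (1 + horiz k ^ 2) * (2 * (1 + vert k ^ 4)) := by gcongr; exact hsq k
        _ = 2 * (1 + vert k ^ 4 + horiz k ^ 2 + horiz k ^ 2 * vert k ^ 4) := by ring
        _ ≤ _ := by gcongr
    refine (lintegral_mono hpt).trans ?_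
    have hYm : Measurable fun s => energyOneOne (c s) := hc.measurable_weightedEnergy _
    rw [lintegral_const_mul' _ _ (by simp), lintegral_add_right _ (hc.measurable_weightedEnergy _),
      lintegral_add_right _ hYm, lintegral_add_right _ (hc.measurable_weightedEnergy _)]
    push_cast
    refine le_trans ?_ le_add_self
    gcongr
    · refine (setLIntegral_mono' measurableSet_Ioc fun s hs => hE s ⟨hs.1.le, hs.2⟩).trans ?_
      rw [setLIntegral_const, hvol]
    · refine (setLIntegral_mono' measurableSet_Ioc fun s hs => hE4 s ⟨hs.1.le, hs.2⟩).trans ?_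
      rw [setLIntegral_const, hvol]
-- Fourier basis of the torus and the convolution formula
/-- The character `x ↦ exp (i k·x)` of the torus. -/
def torusMonomial (k : Fin 2 → ℤ) : C(Torus2, ℂ) where
  toFun x := ∏ j : Fin 2, fourier (k j) (x j)
  continuous_toFun := by fun_prop

theorem torusMonomial_apply (k : Fin 2 → ℤ) (x : Torus2) :
    torusMonomial k x = ∏ j : Fin 2, fourier (k j) (x j) := rfl

theorem torusMonomial_neg (k : Fin 2 → ℤ) (x : Torus2) :
    torusMonomial (-k) x = (starRingEnd ℂ) (torusMonomial k x) := by
  simp only [torusMonomial_apply, Pi.neg_apply, fourier_neg, map_prod]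

theorem torusMonomial_add (k l : Fin 2 → ℤ) (x : Torus2) :
    torusMonomial (k + l) x = torusMonomial k x * torusMonomial l x := by
  simp only [torusMonomial_apply, Pi.add_apply, fourier_add, Finset.prod_mul_distrib]

theorem torusMonomial_zero : torusMonomial 0 = 1 := by
  ext x
  simp [torusMonomial_apply]

theorem torusMonomial_single (x : Torus2) (i : Fin 2) :
    torusMonomial (Pi.single i 1) x = fourier 1 (x i) := by
  fin_cases i <;> simp [torusMonomial_apply]

theorem norm_torusMonomial_apply (k : Fin 2 → ℤ) (x : Torus2) : ‖torusMonomial k x‖ = 1 := by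
  simp only [torusMonomial_apply, fourier_apply, norm_prod, Circle.norm_coe,
    Finset.prod_const_one]

/-- Stone-Weierstrass: the span of the characters is a star subalgebra, and the two coordinate
characters already separate points. -/
theorem span_torusMonomial_topologicalClosure :
    (Submodule.span ℂ (range torusMonomial)).topologicalClosure = ⊤ := by
  let A : StarSubalgebra ℂ C(Torus2, ℂ) :=
    { toSubalgebra := Algebra.adjoin ℂ (range torusMonomial)
      star_mem' := by
        change Algebra.adjoin ℂ (range torusMonomial) ≤
          star (Algebra.adjoin ℂ (range torusMonomial))
        refine Algebra.adjoin_le ?_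
        rintro _ ⟨n, rfl⟩
        refine Algebra.subset_adjoin ⟨-n, ?_⟩
        ext1 x
        simp only [torusMonomial_neg, starRingEnd_apply, ContinuousMap.star_apply] }
  have hA : A.toSubalgebra.toSubmodule = Submodule.span ℂ (range torusMonomial) := by
    apply Algebra.adjoin_eq_span_of_subset
    refine .trans (fun x ↦ Submonoid.closure_induction (fun _ ↦ id) ⟨0, torusMonomial_zero⟩ ?_)
      Submodule.subset_span
    rintro _ _ _ _ ⟨m, rfl⟩ ⟨n, rfl⟩
    exact ⟨m + n, ContinuousMap.ext fun x => torusMonomial_add m n x⟩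
  have hsep : A.SeparatesPoints := by
    intro x y hxy
    obtain ⟨i, hi⟩ := Function.ne_iff.mp hxy
    refine ⟨_, ⟨torusMonomial (Pi.single i 1), Algebra.subset_adjoin ⟨Pi.single i 1, rfl⟩, rfl⟩, ?_⟩
    dsimp only
    rw [torusMonomial_single, torusMonomial_single, fourier_one, fourier_one]
    exact fun h => hi (AddCircle.injective_toCircle Real.two_pi_pos.ne' (Subtype.ext h))
  rw [← hA]
  exact congr_arg (Subalgebra.toSubmodule <| StarSubalgebra.toSubalgebra ·)
    (ContinuousMap.starSubalgebra_topologicalClosure_eq_top_of_separatesPoints A hsep)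

theorem integral_fourier (n : ℤ) :
    ∫ x : AddCircle (2 * Real.pi), (fourier n x : ℂ) = if n = 0 then 2 * (Real.pi : ℂ) else 0 := by
  have h := orthonormal_iff_ite.mp (orthonormal_fourier (T := 2 * Real.pi)) 0 n
  simp only [fourierLp, ContinuousMap.inner_toLp, ← fourier_neg, ← fourier_add] at h
  rw [AddCircle.volume_eq_smul_haarAddCircle, integral_smul_measure,
    ENNReal.toReal_ofReal Real.two_pi_pos.le]
  simp only [neg_zero, add_zero] at h
  rw [h]
  by_cases h0 : n = 0
  · simp [h0]
  · simp [h0, Ne.symm h0]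

theorem integral_torusMonomial (k : Fin 2 → ℤ) :
    ∫ x : Torus2, torusMonomial k x = if k = 0 then (2 * (Real.pi : ℂ)) ^ 2 else 0 := by
  simp only [torusMonomial_apply]
  rw [MeasureTheory.integral_fintype_prod_volume_eq_prod
    (f := fun (i : Fin 2) (y : AddCircle (2 * Real.pi)) => (fourier (k i) y : ℂ))]
  simp only [integral_fourier]
  split_ifs with h
  · simp [h, sq]
  · obtain ⟨i, hi⟩ := Function.ne_iff.mp h
    exact Finset.prod_eq_zero (Finset.mem_univ i) (if_neg hi)

/-- The characters, normalised in `L²(𝕋²)`. -/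
def monomialLp (k : Fin 2 → ℤ) : Lp ℂ 2 (volume : Measure Torus2) :=
  ContinuousMap.toLp 2 volume ℂ ((2 * (Real.pi : ℂ))⁻¹ • torusMonomial k)

theorem coeFn_monomialLp (k : Fin 2 → ℤ) :
    monomialLp k =ᵐ[volume] fun x => (2 * (Real.pi : ℂ))⁻¹ * torusMonomial k x :=
  ContinuousMap.coeFn_toLp volume _

theorem two_pi_ne_zero' : (2 * (Real.pi : ℂ)) ≠ 0 := by
  exact_mod_cast Real.two_pi_pos.ne'

theorem orthonormal_monomialLp : Orthonormal ℂ monomialLp := by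
  rw [orthonormal_iff_ite]
  intro m n
  have hpi := two_pi_ne_zero'
  rw [monomialLp, monomialLp, ContinuousMap.inner_toLp]
  have : ∀ x : Torus2, ((2 * (Real.pi : ℂ))⁻¹ • torusMonomial n) x *
      (starRingEnd ℂ) (((2 * (Real.pi : ℂ))⁻¹ • torusMonomial m) x) =
      ((2 * (Real.pi : ℂ)) ^ 2)⁻¹ * torusMonomial (n + -m) x := by
    intro x
    rw [torusMonomial_add, torusMonomial_neg]
    simp [map_ofNat]
    ring
  simp only [this]
  rw [integral_const_mul, integral_torusMonomial]
  by_cases h : m = n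
  · rw [if_pos h, if_pos (by rw [h, add_neg_cancel]), inv_mul_cancel₀ (pow_ne_zero 2 hpi)]
  · rw [if_neg h, if_neg (fun h' => h (by rw [← sub_eq_add_neg, sub_eq_zero] at h'; exact h'.symm)),
      mul_zero]

theorem span_monomialLp_topologicalClosure :
    (Submodule.span ℂ (range monomialLp)).topologicalClosure = ⊤ := by
  have h := (ContinuousMap.toLp_denseRange ℂ (volume : Measure Torus2) ℂ
    ENNReal.ofNat_ne_top (p := 2)).topologicalClosure_map_submodule
      span_torusMonomial_topologicalClosure
  refine top_le_iff.mp (h.ge.trans (Submodule.topologicalClosure_mono ?_))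
  rw [Submodule.map_span, Submodule.span_le]
  rintro _ ⟨_, ⟨k, rfl⟩, rfl⟩
  have : ContinuousMap.toLp 2 (volume : Measure Torus2) ℂ (torusMonomial k) =
      (2 * (Real.pi : ℂ)) • monomialLp k := by
    rw [monomialLp, map_smul, smul_inv_smul₀ two_pi_ne_zero']
  simp only [ContinuousLinearMap.coe_coe, SetLike.mem_coe, this]
  exact Submodule.smul_mem _ _ (Submodule.subset_span ⟨k, rfl⟩)

/-- The Fourier basis of `L²(𝕋²)`. -/
def torusBasis : HilbertBasis (Fin 2 → ℤ) ℂ (Lp ℂ 2 (volume : Measure Torus2)) :=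
  HilbertBasis.mk orthonormal_monomialLp span_monomialLp_topologicalClosure.ge

/-- The Fourier coefficient `(2π)⁻² ∫ f(x) e^{-i k·x} dx`. -/
def torusCoeff (f : Torus2 → ℂ) (k : Fin 2 → ℤ) : ℂ :=
  (1 / (2 * (Real.pi : ℂ)) ^ 2) * ∫ x : Torus2, f x * torusMonomial (-k) x

/-- The Fourier coefficients of a product are the convolution of the Fourier coefficients. -/
theorem hasSum_torusCoeff_mul {f g : Torus2 → ℂ} (hf : MemLp f 2 volume) (hg : MemLp g 2 volume)
    (k : Fin 2 → ℤ) :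
    HasSum (fun p => torusCoeff g p * torusCoeff f (k - p))
      (torusCoeff (fun x => g x * f x) k) := by
  have hpi := two_pi_ne_zero'
  -- Parseval for the pair conj(f) e_k and g: the inner product is the k-th coefficient of the
  -- product up to a factor, and the basis coefficients are those of f at k - p and of g at p.
  have hF : MemLp (fun x => (starRingEnd ℂ) (f x) * torusMonomial k x) 2 volume := by
    refine hf.of_le ((Complex.continuous_conj.comp_aestronglyMeasurable hf.1).mul
      (torusMonomial k).continuous.aestronglyMeasurable) (ae_of_all _ fun x => ?_)
    simp [norm_torusMonomial_apply]
  have h := torusBasis.hasSum_inner_mul_inner (hF.toLp _) (hg.toLp _)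
  have h0 : inner ℂ (hF.toLp _) (hg.toLp _) =
      (2 * (Real.pi : ℂ)) ^ 2 * torusCoeff (fun x => g x * f x) k := by
    rw [torusCoeff, ← mul_assoc, mul_one_div_cancel (pow_ne_zero 2 hpi), one_mul,
      MeasureTheory.L2.inner_def]
    refine integral_congr_ae ?_
    filter_upwards [hF.coeFn_toLp, hg.coeFn_toLp] with x h1 h2
    rw [h1, h2, RCLike.inner_apply, torusMonomial_neg]
    simp
    ring
  have h1 : ∀ p, inner ℂ (hF.toLp _) (torusBasis p) =
      (2 * (Real.pi : ℂ)) * torusCoeff f (k - p) := by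
    intro p
    rw [torusBasis, HilbertBasis.coe_mk, MeasureTheory.L2.inner_def, torusCoeff, ← mul_assoc,
      show 2 * (Real.pi : ℂ) * (1 / (2 * (Real.pi : ℂ)) ^ 2) = (2 * (Real.pi : ℂ))⁻¹ by
        field_simp, ← integral_const_mul]
    refine integral_congr_ae ?_
    filter_upwards [hF.coeFn_toLp, coeFn_monomialLp p] with x h1 h2
    rw [h1, h2, RCLike.inner_apply, show -(k - p) = p + -k by abel, torusMonomial_add,
      torusMonomial_neg]
    simp
    ring
  have h2 : ∀ p, inner ℂ (torusBasis p) (hg.toLp _) =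
      (2 * (Real.pi : ℂ)) * torusCoeff g p := by
    intro p
    rw [torusBasis, HilbertBasis.coe_mk, MeasureTheory.L2.inner_def, torusCoeff, ← mul_assoc,
      show 2 * (Real.pi : ℂ) * (1 / (2 * (Real.pi : ℂ)) ^ 2) = (2 * (Real.pi : ℂ))⁻¹ by
        field_simp, ← integral_const_mul]
    refine integral_congr_ae ?_
    filter_upwards [hg.coeFn_toLp, coeFn_monomialLp p] with x h1 h2
    rw [h1, h2, RCLike.inner_apply, torusMonomial_neg]
    simp [map_ofNat]
    ring
  simp only [h0, h1, h2] at h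
  have h3 := h.mul_left ((2 * (Real.pi : ℂ)) ^ 2)⁻¹
  rw [inv_mul_cancel_left₀ (pow_ne_zero 2 hpi)] at h3
  refine h3.congr_fun fun p => ?_
  field_simp
-- Trigonometric test functions
theorem torusMonomial_add_apply (k : Fin 2 → ℤ) (x y : Torus2) :
    torusMonomial k (x + y) = torusMonomial k x * torusMonomial k y := by
  simp only [torusMonomial_apply, Pi.add_apply, fourier_apply, smul_add, AddCircle.toCircle_add,
    Circle.coe_mul, Finset.prod_mul_distrib]

theorem fourier_coe_eq_exp (n : ℤ) (y : ℝ) :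
    fourier n (y : AddCircle (2 * Real.pi)) = Complex.exp (Complex.I * n * y) := by
  have hpi := two_pi_ne_zero'
  rw [fourier_coe_apply]
  congr 1
  push_cast
  field_simp

theorem torusMonomial_single_apply (k : Fin 2 → ℤ) (j : Fin 2) (h : ℝ) :
    torusMonomial k (Pi.single j ((h : ℝ) : AddCircle (2 * Real.pi))) =
      Complex.exp (Complex.I * k j * h) := by
  rw [← fourier_coe_eq_exp, torusMonomial_apply, Fin.prod_univ_two]
  fin_cases j <;> simp

/-- The real trigonometric monomial `Re (z exp (i k·x))`. -/
def character (k : Fin 2 → ℤ) (z : ℂ) (x : Torus2) : ℝ := (z * torusMonomial k x).re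

theorem torusSmooth_character (k : Fin 2 → ℤ) (z : ℂ) : TorusSmooth (character k z) := by
  have h : (fun y : Fin 2 → ℝ => character k z (fun i => ((y i : ℝ) : AddCircle (2 * Real.pi)))) =
      fun y => Complex.reCLM (z * ∏ j : Fin 2, Complex.exp (Complex.I * k j * y j)) := by
    funext y
    simp only [character, torusMonomial_apply, fourier_coe_eq_exp, Complex.reCLM_apply]
  rw [TorusSmooth, h]
  refine Complex.reCLM.contDiff.comp (contDiff_const.mul (contDiff_prod fun j _ => ?_))
  exact (contDiff_const.mul (Complex.ofRealCLM.contDiff.comp (contDiff_apply ℝ ℝ j))).cexp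

theorem hasDerivAt_character (k : Fin 2 → ℤ) (z : ℂ) (j : Fin 2) (x : Torus2) :
    HasDerivAt (fun h : ℝ => character k z (x + Pi.single j ((h : ℝ) : AddCircle (2 * Real.pi))))
      (character k (Complex.I * k j * z) x) 0 := by
  have h1 : HasDerivAt (fun h : ℝ => Complex.exp (Complex.I * k j * h)) (Complex.I * k j) 0 := by
    have := ((Complex.ofRealCLM.hasDerivAt (x := (0 : ℝ))).const_mul (Complex.I * k j)).cexp
    simpa using this
  have h2 := (h1.const_mul (z * torusMonomial k x))
  have h3 := Complex.reCLM.hasFDerivAt.comp_hasDerivAt (0 : ℝ) h2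
  convert! h3 using 1
  · funext h
    simp [character, torusMonomial_add_apply, torusMonomial_single_apply, mul_assoc]
  · simp only [character, Complex.reCLM_apply]
    congr 1
    ring

theorem pderiv_character (k : Fin 2 → ℤ) (z : ℂ) (j : Fin 2) :
    pderiv j (character k z) = character k (Complex.I * k j * z) :=
  funext fun x => (hasDerivAt_character k z j x).deriv

/-- The real trigonometric monomial `Re (z exp (i k·x)) ξ` with values in `ℝ²`. -/
def characterField (k : Fin 2 → ℤ) (z : ℂ) (ξ : Vec2) (x : Torus2) : Vec2 := character k z x • ξ

theorem pderiv_characterField (k : Fin 2 → ℤ) (z : ℂ) (ξ : Vec2) (j : Fin 2) :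
    pderiv j (characterField k z ξ) = characterField k (Complex.I * k j * z) ξ :=
  funext fun x => ((hasDerivAt_character k z j x).smul_const ξ).deriv

theorem isTestField_characterField (k : Fin 2 → ℤ) (z : ℂ) (ξ : Vec2)
    (h : ξ 0 * k 0 + ξ 1 * k 1 = 0) : IsTestField (characterField k z ξ) := by
  refine ⟨(torusSmooth_character k z).smul contDiff_const, fun x => ?_⟩
  simp only [pderiv_characterField, characterField, Fin.sum_univ_two, PiLp.smul_apply, smul_eq_mul]
  have e : ∀ j, character k (Complex.I * k j * z) x = k j * character k (Complex.I * z) x := by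
    intro j
    rw [character, character, ← Complex.re_ofReal_mul]
    congr 1
    push_cast
    ring
  rw [e, e]
  linear_combination character k (Complex.I * z) x * h

/-- Because z is an arbitrary complex number, real test functions recover the full complex
coefficient. -/
theorem integral_mul_character {f : Torus2 → ℝ} (hf : Integrable f) (k : Fin 2 → ℤ) (z : ℂ) :
    ∫ x, f x * character (-k) z x =
      (2 * Real.pi) ^ 2 * (z * torusCoeff (fun x => (f x : ℂ)) k).re := by
  have hi : Integrable (fun x => (f x : ℂ) * torusMonomial (-k) x) :=
    hf.ofReal.mul_bdd (c := 1) (torusMonomial (-k)).continuous.aestronglyMeasurable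
      (ae_of_all _ fun x => (norm_torusMonomial_apply _ x).le)
  have h1 : ∀ x, f x * character (-k) z x = (z * ((f x : ℂ) * torusMonomial (-k) x)).re := by
    intro x
    rw [character, ← Complex.re_ofReal_mul]
    congr 1
    ring
  simp only [h1]
  have h2 := integral_re (hi.const_mul z)
  simp only [RCLike.re_eq_complex_re] at h2
  rw [h2, integral_const_mul, torusCoeff, ← Complex.re_ofReal_mul]
  congr 1
  have hpi := two_pi_ne_zero'
  push_cast
  field_simp
-- Fourier form of the weak formulation
theorem memLp_component (u : L2Field) (i : Fin 2) : MemLp (fun x => u x i) 2 volume :=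
  (EuclideanSpace.proj i : Vec2 →L[ℝ] ℝ).comp_memLp' (Lp.memLp u)

theorem integrable_component (u : L2Field) (i : Fin 2) : Integrable (fun x => u x i) :=
  (memLp_component u i).integrable one_le_two

/-- The Fourier coefficients of a square integrable field. -/
def fieldMode (u : L2Field) : FourierField := fun k => WithLp.toLp 2 (fieldCoeff u k)

theorem fieldMode_apply (u : L2Field) (k : Fin 2 → ℤ) (i : Fin 2) :
    fieldMode u k i = fieldCoeff u k i := rfl

theorem fieldCoeff_eq_torusCoeff (u : L2Field) (k : Fin 2 → ℤ) (i : Fin 2) :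
    fieldCoeff u k i = torusCoeff (fun x => ((u x i : ℝ) : ℂ)) k := rfl

theorem enorm_fieldMode_sq (u : L2Field) (k : Fin 2 → ℤ) :
    ‖fieldMode u k‖ₑ ^ 2 = ENNReal.ofReal (fourierNormSq u k) := by
  rw [← ofReal_norm, ← ENNReal.ofReal_pow (norm_nonneg _), EuclideanSpace.norm_sq_eq]
  rfl

theorem ofReal_one_add_sq (n : ℤ) : ENNReal.ofReal (1 + (n : ℝ) ^ 2) = 1 + (n.natAbs : ℝ≥0∞) ^ 2 := by
  rw [ENNReal.ofReal_add zero_le_one (sq_nonneg _), ENNReal.ofReal_one, ← sq_abs,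
    ENNReal.ofReal_pow (abs_nonneg _), ← Int.cast_abs, ← Nat.cast_natAbs, ENNReal.ofReal_natCast]

theorem anisoNormSq_eq_weightedEnergy (m n : ℕ) (u : L2Field) :
    anisoNormSq m n u =
      weightedEnergy (fun k => (1 + horiz k ^ 2) ^ m * (1 + vert k ^ 2) ^ n) (fieldMode u) := by
  refine tsum_congr fun k => ?_
  have h : ∀ n : ℤ, (0 : ℝ) ≤ 1 + (n : ℝ) ^ 2 := fun n => by positivity
  rw [enorm_fieldMode_sq, Real.rpow_natCast, Real.rpow_natCast,
    ENNReal.ofReal_mul (mul_nonneg (pow_nonneg (h _) _) (pow_nonneg (h _) _)),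
    ENNReal.ofReal_mul (pow_nonneg (h _) _), ENNReal.ofReal_pow (h _), ENNReal.ofReal_pow (h _),
    ofReal_one_add_sq, ofReal_one_add_sq]
  rfl

theorem fieldCoeff_neg (u : L2Field) (k : Fin 2 → ℤ) (i : Fin 2) :
    fieldCoeff u (-k) i = (starRingEnd ℂ) (fieldCoeff u k i) := by
  rw [fieldCoeff_eq_torusCoeff, fieldCoeff_eq_torusCoeff, torusCoeff, torusCoeff, map_mul,
    ← integral_conj]
  congr 1
  · simp [map_ofNat]
  · refine integral_congr_ae (ae_of_all _ fun x => ?_)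
    simp [torusMonomial_neg]

theorem fieldCoeff_sub (u v : L2Field) (k : Fin 2 → ℤ) (i : Fin 2) :
    fieldCoeff (u - v) k i = fieldCoeff u k i - fieldCoeff v k i := by
  have hi : ∀ w : L2Field, Integrable (fun x => ((w x i : ℝ) : ℂ) * torusMonomial (-k) x) :=
    fun w => (integrable_component w i).ofReal.mul_bdd (c := 1)
      (torusMonomial (-k)).continuous.aestronglyMeasurable
      (ae_of_all _ fun x => (norm_torusMonomial_apply _ x).le)
  simp only [fieldCoeff_eq_torusCoeff, torusCoeff]
  rw [← mul_sub, ← integral_sub (hi u) (hi v)]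
  congr 1
  refine integral_congr_ae ?_
  filter_upwards [Lp.coeFn_sub u v] with x hx
  simp only [hx, Pi.sub_apply, PiLp.sub_apply, Complex.ofReal_sub, sub_mul]

theorem integral_sum_mul_character (u : L2Field) (k : Fin 2 → ℤ) (z : Fin 2 → ℂ) :
    ∫ x : Torus2, ∑ j : Fin 2, u x j * character (-k) (z j) x =
      (2 * Real.pi) ^ 2 * (z 0 * fieldCoeff u k 0 + z 1 * fieldCoeff u k 1).re := by
  have hi : ∀ j, Integrable (fun x => u x j * character (-k) (z j) x) := fun j =>
    (integrable_component u j).mul_bdd (c := ‖z j‖)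
      (Complex.continuous_re.comp (continuous_const.mul
        (torusMonomial (-k)).continuous)).aestronglyMeasurable
      (ae_of_all _ fun x => (Complex.abs_re_le_norm _).trans (by
        rw [norm_mul, norm_torusMonomial_apply, mul_one]))
  simp only [Fin.sum_univ_two]
  rw [integral_add (hi 0) (hi 1), integral_mul_character (integrable_component u 0),
    integral_mul_character (integrable_component u 1), Complex.add_re, mul_add]
  rfl

theorem DivFree.fieldMode_div {u : L2Field} (hu : DivFree u) (k : Fin 2 → ℤ) :
    (k 0 : ℂ) * fieldMode u k 0 + (k 1 : ℂ) * fieldMode u k 1 = 0 := by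
  have h : ∀ z : ℂ, (z * ((k 0 : ℂ) * fieldCoeff u k 0 + (k 1 : ℂ) * fieldCoeff u k 1)).re = 0 := by
    intro z
    have h1 := hu _ (torusSmooth_character (-k) (Complex.I * z))
    simp only [pderiv_character] at h1
    rw [integral_sum_mul_character] at h1
    have h2 := (mul_eq_zero.mp h1).resolve_left (pow_ne_zero 2 Real.two_pi_pos.ne')
    rw [← h2]
    congr 1
    simp only [Pi.neg_apply, Int.cast_neg]
    linear_combination (z * ((k 0 : ℂ) * fieldCoeff u k 0 + (k 1 : ℂ) * fieldCoeff u k 1)) *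
      Complex.I_mul_I
  refine Complex.ext ?_ ?_
  · simpa [fieldMode_apply] using h 1
  · simpa [fieldMode_apply] using h (-Complex.I)

theorem DivFree.isRealDivFree {u : L2Field} (hu : DivFree u) : IsRealDivFree (fieldMode u) :=
  ⟨hu.fieldMode_div, fieldCoeff_neg u⟩

theorem pairing_characterField (u : L2Field) (k : Fin 2 → ℤ) (z : ℂ) (ξ : Vec2) :
    pairing u (characterField (-k) z ξ) =
      (2 * Real.pi) ^ 2 * (z * (ξ 0 * fieldMode u k 0 + ξ 1 * fieldMode u k 1)).re := by
  have h := integral_sum_mul_character u k (fun i => ξ i * z)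
  have e : ∀ x i, characterField (-k) z ξ x i = character (-k) (ξ i * z) x := by
    intro x i
    rw [character, mul_assoc, Complex.re_ofReal_mul, characterField, PiLp.smul_apply, smul_eq_mul,
      mul_comm, character]
  simp only [pairing, e, h]
  congr 2
  simp only [fieldMode_apply]
  ring

theorem viscousForm_characterField (u : L2Field) (k : Fin 2 → ℤ) (z : ℂ) (ξ : Vec2) :
    viscousForm u (characterField (-k) z ξ) =
      (2 * Real.pi) ^ 2 *
        (z * -((k 0 : ℂ) ^ 2 * (ξ 0 * fieldMode u k 0 + ξ 1 * fieldMode u k 1))).re := by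
  rw [viscousForm, pderiv_characterField, pderiv_characterField, pairing_characterField]
  congr 2
  simp only [Pi.neg_apply, Int.cast_neg]
  linear_combination (k 0 : ℂ) ^ 2 * z * (ξ 0 * fieldMode u k 0 + ξ 1 * fieldMode u k 1) *
    Complex.I_mul_I

/-- The sum over p is k · (û ∗ û_i), which the convolution formula identifies with coefficients of
the integrable products u_j u_i. -/
theorem convectionCoeff_fieldMode (u : L2Field) (k : Fin 2 → ℤ) (i : Fin 2) :
    convectionCoeff (fieldMode u) k i =
      k 0 * torusCoeff (fun x => ((u x 0 * u x i : ℝ) : ℂ)) k +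
        k 1 * torusCoeff (fun x => ((u x 1 * u x i : ℝ) : ℂ)) k := by
  have h := fun j => hasSum_torusCoeff_mul (memLp_component u i).ofReal
    (memLp_component u j).ofReal k
  have h2 := ((h 0).mul_left (k 0 : ℂ)).add ((h 1).mul_left (k 1 : ℂ))
  rw [convectionCoeff]
  simp only [Complex.ofReal_mul]
  refine Eq.trans (tsum_congr fun p => ?_) h2.tsum_eq
  simp only [fieldMode_apply, fieldCoeff_eq_torusCoeff]
  simp only [RCLike.ofReal_eq_complex_ofReal]
  ring

theorem convectionForm_characterField (u : L2Field) (k : Fin 2 → ℤ) (z : ℂ) (ξ : Vec2) :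
    convectionForm u (characterField (-k) z ξ) =
      (2 * Real.pi) ^ 2 * (z * (Complex.I * (ξ 0 * convectionCoeff (fieldMode u) k 0 +
        ξ 1 * convectionCoeff (fieldMode u) k 1))).re := by
  have hm : ∀ i j, Integrable (fun x => u x j * u x i) := fun i j =>
    (memLp_component u j).integrable_mul (memLp_component u i)
  let w : Fin 2 → Fin 2 → ℂ := fun i j => ξ i * (Complex.I * (-k) j * z)
  have e : ∀ x i j, pderiv j (characterField (-k) z ξ) x i = character (-k) (w i j) x := by
    intro x i j
    rw [character, mul_assoc, Complex.re_ofReal_mul, pderiv_characterField, characterField,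
      PiLp.smul_apply, smul_eq_mul, mul_comm, character]
  have hi : ∀ i j, Integrable (fun x => u x j * u x i * character (-k) (w i j) x) := fun i j =>
    (hm i j).mul_bdd (c := ‖w i j‖)
      (Complex.continuous_re.comp (continuous_const.mul
        (torusMonomial (-k)).continuous)).aestronglyMeasurable
      (ae_of_all _ fun x => (Complex.abs_re_le_norm _).trans (by
        rw [norm_mul, norm_torusMonomial_apply, mul_one]))
  simp only [convectionForm, e]
  rw [integral_finsetSum _ fun i _ => integrable_finsetSum _ fun j _ => hi i j]
  simp only [Fin.sum_univ_two]
  rw [integral_add (hi 0 0) (hi 0 1), integral_add (hi 1 0) (hi 1 1),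
    integral_mul_character (hm 0 0),
    integral_mul_character (hm 0 1), integral_mul_character (hm 1 0),
    integral_mul_character (hm 1 1), convectionCoeff_fieldMode, convectionCoeff_fieldMode,
    ← mul_add, ← mul_add, ← mul_add, ← mul_neg]
  congr 1
  simp only [← Complex.add_re, ← Complex.neg_re]
  congr 1
  simp only [w, Pi.neg_apply, Int.cast_neg]
  ring

/-- A single coefficient is controlled by the H^{-1} norm, with a constant depending on k. -/
theorem tendsto_fieldCoeff {u : ℝ → L2Field} {l : Filter ℝ} {v : L2Field}
    (h : Tendsto (fun s => sobolevNormSq (-1) (u s - v)) l (𝓝 0)) (k : Fin 2 → ℤ) (i : Fin 2) :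
    Tendsto (fun s => fieldCoeff (u s) k i) l (𝓝 (fieldCoeff v k i)) := by
  set w : ℝ := (1 + ((k 0 : ℝ) ^ 2 + (k 1 : ℝ) ^ 2)) ^ (-1 : ℝ) with hw
  have hw0 : 0 < w := by positivity
  have h1 : Tendsto (fun s => ENNReal.ofReal (w * ‖fieldCoeff (u s) k i - fieldCoeff v k i‖ ^ 2))
      l (𝓝 0) := by
    refine tendsto_of_tendsto_of_tendsto_of_le_of_le tendsto_const_nhds h (fun _ => zero_le)
      fun s => ?_
    refine le_trans ?_ (ENNReal.le_tsum k)
    refine ENNReal.ofReal_le_ofReal (mul_le_mul_of_nonneg_left ?_ hw0.le)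
    rw [← fieldCoeff_sub]
    exact Finset.single_le_sum (f := fun i => ‖fieldCoeff (u s - v) k i‖ ^ 2)
      (fun _ _ => sq_nonneg _) (Finset.mem_univ i)
  have h2 := (ENNReal.tendsto_toReal ENNReal.zero_ne_top).comp h1
  have h3 := ((h2.const_mul w⁻¹).sqrt)
  rw [tendsto_iff_norm_sub_tendsto_zero]
  convert! h3 using 1
  · funext s
    rw [Function.comp_apply, ENNReal.toReal_ofReal (by positivity), inv_mul_cancel_left₀ hw0.ne',
      Real.sqrt_sq (norm_nonneg _)]
  · simp
-- From weak solutions to Fourier solutions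
/-- A weighted energy of continuous modes that is bounded almost everywhere is bounded. -/
theorem weightedEnergy_le_of_ae {T : ℝ} (hT : 0 < T) {c : ℝ → FourierField}
    (hc : ∀ k i, Continuous fun s => c s k i) {ω : (Fin 2 → ℤ) → ℝ≥0∞} (hω : ∀ k, ω k ≠ ⊤)
    {M : ℝ≥0∞} (h : ∀ᵐ t ∂(volume.restrict (Icc 0 T)), weightedEnergy ω (c t) ≤ M) :
    ∀ t ∈ Icc 0 T, weightedEnergy ω (c t) ≤ M := by
  intro t ht
  rw [weightedEnergy, ENNReal.tsum_eq_iSup_sum]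
  refine iSup_le fun F => ?_
  have hcont : Continuous fun s => ∑ k ∈ F, ω k * ‖c s k‖ₑ ^ 2 := by
    refine continuous_finsetSum _ fun k _ => ?_
    have h1 : Continuous fun s => c s k :=
      (PiLp.continuous_toLp 2 _).comp (continuous_pi fun i => hc k i)
    exact ENNReal.continuous_const_mul (hω k) |>.comp ((ENNReal.continuous_pow 2).comp h1.enorm)
  have hclosed : IsClosed {s | ∑ k ∈ F, ω k * ‖c s k‖ₑ ^ 2 ≤ M} :=
    isClosed_le hcont continuous_const
  -- For finitely many modes the exceptional set in (0,T) is open and null, hence empty; closedness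
  -- then adds the endpoints.
  have hsub : Ioo 0 T ⊆ {s | ∑ k ∈ F, ω k * ‖c s k‖ₑ ^ 2 ≤ M} := by
    have hopen : IsOpen (Ioo 0 T ∩ {s | ∑ k ∈ F, ω k * ‖c s k‖ₑ ^ 2 ≤ M}ᶜ) :=
      isOpen_Ioo.inter hclosed.isOpen_compl
    have hnull : volume (Ioo 0 T ∩ {s | ∑ k ∈ F, ω k * ‖c s k‖ₑ ^ 2 ≤ M}ᶜ) = 0 := by
      rw [ae_restrict_iff' measurableSet_Icc] at h
      refine measure_mono_null ?_ h
      rintro s ⟨hs, hs'⟩ hs''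
      exact hs' ((ENNReal.sum_le_tsum F).trans (hs'' (Ioo_subset_Icc_self hs)))
    have hempty := hopen.measure_eq_zero_iff volume |>.mp hnull
    rw [← disjoint_iff_inter_eq_empty, disjoint_compl_right_iff_subset] at hempty
    exact hempty
  have := closure_minimal hsub hclosed
  rw [closure_Ioo hT.ne] at this
  exact this ht

theorem one_add_sq_le (a : ℝ≥0∞) : (1 + a) ^ 2 ≤ 2 * (1 + a ^ 2) := by
  simpa using add_sq_le_two_mul 1 a

/-- The time dependent Fourier coefficients of a field on `[0, T]`, constant outside `[0, T]`. -/
def solutionMode {T : ℝ} (hT : 0 ≤ T) (u : ℝ → L2Field) (s : ℝ) : FourierField :=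
  fieldMode (u (projIcc 0 T hT s))

theorem solutionMode_of_mem {T : ℝ} (hT : 0 ≤ T) (u : ℝ → L2Field) {s : ℝ} (hs : s ∈ Icc 0 T) :
    solutionMode hT u s = fieldMode (u s) := by
  rw [solutionMode, projIcc_of_mem hT hs]

namespace IsSolution

variable {T : ℝ} {u₀ : L2Field} {u : ℝ → L2Field}

theorem continuous_solutionMode (hu : IsSolution T u₀ u) (hT : 0 ≤ T) (k : Fin 2 → ℤ)
    (i : Fin 2) : Continuous fun s => solutionMode hT u s k i := by
  have h : ContinuousOn (fun s => fieldCoeff (u s) k i) (Icc 0 T) := fun t ht =>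
    tendsto_fieldCoeff (hu.continuous t ht) k i
  exact (continuousOn_iff_continuous_domRestrict.mp h).comp continuous_projIcc

theorem exists_bound (hu : IsSolution T u₀ u) (hT : 0 < T) :
    ∃ M : ℝ≥0, ∀ s, weightedEnergy (fun k => (1 + vert k) ^ 2) (solutionMode hT.le u s) ≤ M := by
  obtain ⟨M, hM⟩ := hu.bounded
  refine ⟨2 * M, fun s => ?_⟩
  have h : ∀ t ∈ Icc 0 T, weightedEnergy (fun k => (1 + vert k) ^ 2) (solutionMode hT.le u t) ≤
      2 * M := by
    refine weightedEnergy_le_of_ae hT (hu.continuous_solutionMode hT.le) (fun k =>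
      ENNReal.pow_ne_top (ENNReal.add_ne_top.2 ⟨ENNReal.one_ne_top, vert_ne_top k⟩)) ?_
    filter_upwards [hM, ae_restrict_mem measurableSet_Icc] with t ht htT
    have e := anisoNormSq_eq_weightedEnergy 0 1 (u t)
    simp only [Nat.cast_zero, Nat.cast_one, pow_zero, pow_one, one_mul] at e
    rw [e] at ht
    rw [solutionMode_of_mem hT.le u htT]
    refine (weightedEnergy_mono (fun k => one_add_sq_le (vert k)) _).trans ?_
    rw [weightedEnergy_const_mul]
    gcongr
  have hs : solutionMode hT.le u s = solutionMode hT.le u (projIcc 0 T hT.le s) := by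
    rw [solutionMode, solutionMode, projIcc_val]
  rw [hs]
  push_cast
  exact h _ (projIcc 0 T hT.le s).2

theorem lintegral_energyOneOne_ne_top (hu : IsSolution T u₀ u) (hT : 0 ≤ T) :
    ∫⁻ s in Ioc 0 T, energyOneOne (solutionMode hT u s) ≠ ⊤ := by
  have h : ∫⁻ s in Ioc 0 T, energyOneOne (solutionMode hT u s) ≤
      4 * ∫⁻ s in Ioc 0 T, anisoNormSq 1 1 (u s) := by
    rw [← lintegral_const_mul' _ _ ENNReal.ofNat_ne_top]
    refine setLIntegral_mono' measurableSet_Ioc fun s hs => ?_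
    have e := anisoNormSq_eq_weightedEnergy 1 1 (u s)
    simp only [Nat.cast_one, pow_one] at e
    rw [solutionMode_of_mem hT u (Ioc_subset_Icc_self hs), e, energyOneOne,
      ← weightedEnergy_const_mul]
    refine weightedEnergy_mono (fun k => ?_) _
    rw [mul_pow]
    calc _ ≤ 2 * (1 + horiz k ^ 2) * (2 * (1 + vert k ^ 2)) :=
          mul_le_mul' (one_add_sq_le _) (one_add_sq_le _)
      _ = _ := by ring
  refine ne_top_of_le_ne_top (ENNReal.mul_ne_top ENNReal.ofNat_ne_top ?_) h
  rw [setLIntegral_congr Ioc_ae_eq_Icc]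
  exact hu.squareIntegrable.ne

/-- The weak equation tested with Re(z e^{-ik·x}) ξ. The condition ξ · k = 0 makes this field
divergence free, so no pressure appears. -/
theorem re_mode_eq (hu : IsSolution T u₀ u) (hT : 0 ≤ T) (k : Fin 2 → ℤ) (ξ : Fin 2 → ℝ)
    (h : ξ 0 * k 0 + ξ 1 * k 1 = 0) (z : ℂ) {t : ℝ} (ht : t ∈ Icc 0 T) :
    (z * (ξ 0 * solutionMode hT u t k 0 + ξ 1 * solutionMode hT u t k 1)).re =
      (z * (ξ 0 * solutionMode hT u 0 k 0 + ξ 1 * solutionMode hT u 0 k 1)).re +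
        ∫ s in (0 : ℝ)..t, (z * (-((k 0 : ℂ) ^ 2 *
          (ξ 0 * solutionMode hT u s k 0 + ξ 1 * solutionMode hT u s k 1)) -
        Complex.I * (ξ 0 * convectionCoeff (solutionMode hT u s) k 0 +
          ξ 1 * convectionCoeff (solutionMode hT u s) k 1))).re := by
  let η : Vec2 := WithLp.toLp 2 ξ
  have htest : IsTestField (characterField (-k) z η) := by
    refine isTestField_characterField _ _ _ ?_
    simp only [Pi.neg_apply, Int.cast_neg, η]
    linear_combination -h
  have he := hu.equation _ htest t ht
  have hint : ∫ s in (0 : ℝ)..t, (viscousForm (u s) (characterField (-k) z η) -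
      convectionForm (u s) (characterField (-k) z η)) =
      (2 * Real.pi) ^ 2 * ∫ s in (0 : ℝ)..t, (z * (-((k 0 : ℂ) ^ 2 *
          (ξ 0 * solutionMode hT u s k 0 + ξ 1 * solutionMode hT u s k 1)) -
        Complex.I * (ξ 0 * convectionCoeff (solutionMode hT u s) k 0 +
          ξ 1 * convectionCoeff (solutionMode hT u s) k 1))).re := by
    rw [← intervalIntegral.integral_const_mul]
    refine intervalIntegral.integral_congr fun s hs => ?_
    rw [uIcc_of_le ht.1] at hs
    simp only
    rw [viscousForm_characterField, convectionForm_characterField,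
      solutionMode_of_mem hT u ⟨hs.1, hs.2.trans ht.2⟩, ← mul_sub, ← Complex.sub_re, ← mul_sub]
  rw [hint, ← hu.initial, pairing_characterField, pairing_characterField, ← mul_add] at he
  rw [solutionMode_of_mem hT u ht, solutionMode_of_mem hT u ⟨le_rfl, hT⟩]
  exact mul_left_cancel₀ (pow_ne_zero 2 Real.two_pi_pos.ne') he

/-- The Fourier coefficients of a solution of the anisotropic Navier-Stokes equation. -/
theorem isFourierSolution (hu : IsSolution T u₀ u) (hT : 0 < T) :
    IsFourierSolution T (solutionMode hT.le u) where
  realDivFree s := (hu.divFree _ (projIcc 0 T hT.le s).2).isRealDivFree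
  continuous := hu.continuous_solutionMode hT.le
  bounded := hu.exists_bound hT
  integrable := hu.lintegral_energyOneOne_ne_top hT.le
  equation k ξ h t ht := by
    obtain ⟨M, hM⟩ := hu.exists_bound hT
    have hcont := hu.continuous_solutionMode hT.le
    have hi : IntervalIntegrable (fun s => -((k 0 : ℂ) ^ 2 *
          (ξ 0 * solutionMode hT.le u s k 0 + ξ 1 * solutionMode hT.le u s k 1)) -
        Complex.I * (ξ 0 * convectionCoeff (solutionMode hT.le u s) k 0 +
          ξ 1 * convectionCoeff (solutionMode hT.le u s) k 1)) volume 0 t := by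
      refine IntervalIntegrable.sub (Continuous.intervalIntegrable ?_ _ _) ?_
      · exact (continuous_const.mul ((continuous_const.mul (hcont k 0)).add
          (continuous_const.mul (hcont k 1)))).neg
      · exact (((intervalIntegrable_convectionCoeff hcont hM k 0 0 t).const_mul _).add
          ((intervalIntegrable_convectionCoeff hcont hM k 1 0 t).const_mul _)).const_mul _
    -- The choices z = 1 and z = -i give the real and the imaginary part.
    have h1 := hu.re_mode_eq hT.le k ξ h 1 ht
    have h2 := hu.re_mode_eq hT.le k ξ h (-Complex.I) ht
    have him : ∀ w : ℂ, (-Complex.I * w).re = w.im := fun w => by simp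
    simp only [one_mul] at h1
    simp only [him] at h2
    refine Complex.ext ?_ ?_
    · rw [h1, Complex.add_re]
      exact congrArg _ (Complex.reCLM.intervalIntegral_comp_comm hi)
    · rw [h2, Complex.add_im]
      exact congrArg _ (Complex.imCLM.intervalIntegral_comp_comm hi)

end IsSolution

end

end AnisotropicNS

theorem mainTheorem4 (T : ℝ) (hT : 0 < T) (R : ℝ≥0) :
    ∃ C : ℝ≥0, ∀ u₀ ∈ AnisotropicNS.anisoSpace 0 2, AnisotropicNS.anisoNormSq 0 2 u₀ ≤ R →
      ∀ u : ℝ → AnisotropicNS.L2Field, AnisotropicNS.IsSolution T u₀ u →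
        (⨆ t ∈ Icc 0 T, AnisotropicNS.anisoNormSq 0 2 (u t)) +
          ∫⁻ t in Icc 0 T, AnisotropicNS.anisoNormSq 1 2 (u t) ≤ C := by
  obtain ⟨C, hC⟩ := AnisotropicNS.exists_second_order_bound hT.le R
  -- One copy of `C` for the supremum, one for the time integral.
  refine ⟨C + C, fun u₀ _ hR u hu => ?_⟩
  have e0 : ∀ w, AnisotropicNS.anisoNormSq 0 2 w = AnisotropicNS.weightedEnergy
      (fun k => (1 + AnisotropicNS.vert k ^ 2) ^ 2) (AnisotropicNS.fieldMode w) := fun w => by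
    simpa using AnisotropicNS.anisoNormSq_eq_weightedEnergy 0 2 w
  have e1 : ∀ w, AnisotropicNS.anisoNormSq 1 2 w = AnisotropicNS.weightedEnergy
      (fun k => (1 + AnisotropicNS.horiz k ^ 2) * (1 + AnisotropicNS.vert k ^ 2) ^ 2)
      (AnisotropicNS.fieldMode w) := fun w => by
    simpa using AnisotropicNS.anisoNormSq_eq_weightedEnergy 1 2 w
  obtain ⟨h1, h2⟩ := hC _ (hu.isFourierSolution hT) (by
    rw [AnisotropicNS.solutionMode_of_mem hT.le u ⟨le_rfl, hT.le⟩, hu.initial, ← e0]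
    exact hR)
  rw [ENNReal.coe_add]
  refine add_le_add (iSup₂_le fun t ht => ?_) ?_
  · rw [e0, ← AnisotropicNS.solutionMode_of_mem hT.le u ht]
    exact h1 t ht
  · rw [← setLIntegral_congr Ioc_ae_eq_Icc]
    refine le_trans (le_of_eq (setLIntegral_congr_fun measurableSet_Ioc fun t ht => ?_)) h2
    rw [e1, ← AnisotropicNS.solutionMode_of_mem hT.le u (Ioc_subset_Icc_self ht)]
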